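/- **Setting.** Let $P$ and $M$ be connected paracompact (Hausdorff, finite-dimensional) smooth manifolds, let $G$ be a Lie group, and let $P(M,G)$ be a smooth principal bundle with projection $p:P\to M$, where $G$ acts smoothly from the left on $P$. Let $\omega$ be a flat connection on $P(M,G)$, i.e. a connection such that every point of $M$ has an open neighbourhood $U$ over which $\omega$ is isomorphic to the product connection on $U\times G$ (equivalently, $U$ admits a smooth section $s:U\to P$ with $s^*\omega=0$). Let $q:\widehat M\to M$ be a regular smooth covering with $\widehat M$ connected, let $\widehat P=\{(m,u)\in\widehat M\times P : q(m)=p(u)\}$ be the total space of the induced principal bundle $\widehat P(\widehat M,G)$, with projection $\widehat p(m,u)=m$ and bundle map $\widehat q:\widehat P\to P$, $\widehat q(m,u)=u$, and let $\widehat\omega=\widehat q^{\,*}\omega$ be the induced connection. Fix $x_0\in P$ and $\widehat x_0\in\widehat q^{-1}(x_0)$. The holonomy morphism $h_\omega:\pi_1(M,p(x_0))\to G$ sends the class of a loop $w$ to the unique $g\in G$ such that the horizontal lift of $w$ starting at $x_0$ ends at $g\,x_0$. The total space of the holonomy bundle of $\omega$ through $x_0$ is the set of points of $P$ that can be joined to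 $x_0$ by a horizontal path. The maximal horizontal leaf $N(x_0)$ is the connected, injectively immersed integral manifold of the horizontal distribution $\ker\omega$ through $x_0$ that contains every other connected integral manifold through $x_0$ (with smooth inclusion). The same notions are used for $\widehat\omega$ and $\widehat x_0$. **Proposition 2.1.** Suppose that $q_\#\bigl(\pi_1(\widehat M,\widehat p(\widehat x_0))\bigr)=\ker h_\omega$ as subgroups of $\pi_1(M,p(x_0))$. Then the holonomy bundles of $\omega$ and $\widehat\omega$ have the same total space. Precisely: the maximal horizontal leaves $N(x_0)\subseteq P$ and $N(\widehat x_0)\subseteq\widehat P$ exist, they are the total spaces of the holonomy bundles of $\omega$ through $x_0$ and of $\widehat\omega$ through $\widehat x_0$ respectively, and $\widehat q$ restricts to a diffeomorphism $N(\widehat x_0)\to N(x_0)$. -/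

import Mathlib

open scoped Manifold ContDiff Topology
open Set

universe u

noncomputable section

namespace FlatCovering

/-! ### Pulling a smooth structure back along a local homeomorphism -/

section Pullback

variable {E : Type*} [NormedAddCommGroup E] [NormedSpace ℝ E]
  {X Y : Type*} [TopologicalSpace X] [TopologicalSpace Y] [ChartedSpace E Y]

/-- The charted space structure on `X` pulled back along a local homeomorphism `f : X → Y`: the
charts are the restrictions of `f` to small open sets followed by charts of `Y`. -/
@[reducible] def pullbackChartedSpace {f : X → Y} (hf : IsLocalHomeomorph f) : ChartedSpace E X where
  atlas := {e | ∃ x : X, e = (hf.localInverseAt x).symm.trans (chartAt E (f x))}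
  chartAt x := (hf.localInverseAt x).symm.trans (chartAt E (f x))
  mem_chart_source x := by
    simp [hf.localInverseAt_symm]
  chart_mem_atlas x := ⟨x, rfl⟩

theorem pullback_isManifold [IsManifold 𝓘(ℝ, E) ∞ Y] {f : X → Y} (hf : IsLocalHomeomorph f) :
    @IsManifold ℝ _ E _ _ E _ 𝓘(ℝ, E) ∞ X _ (pullbackChartedSpace hf) := by
  let := pullbackChartedSpace (E := E) hf
  refine @IsManifold.mk' _ _ _ _ _ _ _ _ _ _ _ _ ⟨?_⟩
  rintro _ _ ⟨x, rfl⟩ ⟨x', rfl⟩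
  have h := (contDiffGroupoid ∞ 𝓘(ℝ, E)).compatible
    (chart_mem_atlas E (f x)) (chart_mem_atlas E (f x'))
  have key : ∀ z ∈ (hf.localInverseAt x).source, f (hf.localInverseAt x z) = z := fun z hz =>
    hf.apply_localInverseAt_of_mem hz
  set F := ((hf.localInverseAt x).symm.trans (chartAt E (f x))).symm.trans
    ((hf.localInverseAt x').symm.trans (chartAt E (f x'))) with hF
  refine StructureGroupoid.mem_of_eqOnSource _ (closedUnderRestriction' h F.open_source) ?_
  have hval : ∀ y ∈ F.source, F y = chartAt E (f x') ((chartAt E (f x)).symm y) := by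
    intro y hy
    simp only [hF, OpenPartialHomeomorph.trans_source, OpenPartialHomeomorph.symm_source,
      OpenPartialHomeomorph.trans_target, mem_inter_iff, mem_preimage] at hy
    simp only [hF, OpenPartialHomeomorph.coe_trans, OpenPartialHomeomorph.coe_trans_symm,
      Function.comp_apply, OpenPartialHomeomorph.symm_symm, hf.localInverseAt_symm]
    rw [key _ hy.1.2]
  refine ⟨?_, fun y hy => ?_⟩
  · rw [OpenPartialHomeomorph.restr_source, F.open_source.interior_eq]
    refine (inter_eq_right.2 fun y hy => ?_).symm
    simp only [hF, OpenPartialHomeomorph.trans_source, OpenPartialHomeomorph.symm_source,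
      OpenPartialHomeomorph.trans_target, OpenPartialHomeomorph.coe_trans_symm,
      Function.comp_apply, OpenPartialHomeomorph.symm_symm, hf.localInverseAt_symm,
      mem_inter_iff, mem_preimage] at hy
    rw [key _ hy.1.2] at hy
    simp only [OpenPartialHomeomorph.trans_source, OpenPartialHomeomorph.symm_source,
      mem_inter_iff, mem_preimage]
    exact ⟨hy.1.1, hy.2.2⟩
  · rw [hval y hy]; rfl

theorem pullback_isLocalDiffeomorph [IsManifold 𝓘(ℝ, E) ∞ Y] {f : X → Y}
    (hf : IsLocalHomeomorph f) :
    letI := pullbackChartedSpace (E := E) hf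
    IsLocalDiffeomorph 𝓘(ℝ, E) 𝓘(ℝ, E) ∞ f := by
  let := pullbackChartedSpace (E := E) hf
  have := pullback_isManifold (E := E) hf
  intro x
  let Ψ : OpenPartialHomeomorph X Y := (chartAt E x).trans (chartAt E (f x)).symm
  have h1 := contMDiffOn_of_mem_maximalAtlas (I := 𝓘(ℝ, E)) (n := ∞)
    (IsManifold.chart_mem_maximalAtlas (I := 𝓘(ℝ, E)) (n := ∞) x)
  have h2 := contMDiffOn_symm_of_mem_maximalAtlas (I := 𝓘(ℝ, E)) (n := ∞)
    (IsManifold.chart_mem_maximalAtlas (I := 𝓘(ℝ, E)) (n := ∞) x)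
  have h3 := contMDiffOn_of_mem_maximalAtlas (I := 𝓘(ℝ, E)) (n := ∞)
    (IsManifold.chart_mem_maximalAtlas (I := 𝓘(ℝ, E)) (n := ∞) (f x))
  have h4 := contMDiffOn_symm_of_mem_maximalAtlas (I := 𝓘(ℝ, E)) (n := ∞)
    (IsManifold.chart_mem_maximalAtlas (I := 𝓘(ℝ, E)) (n := ∞) (f x))
  have hc : (chartAt E x : OpenPartialHomeomorph X E) =
    (hf.localInverseAt x).symm.trans (chartAt E (f x)) := rfl
  refine ⟨{ toPartialEquiv := Ψ.toPartialEquiv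
            open_source := Ψ.open_source
            open_target := Ψ.open_target
            contMDiffOn_toFun := ?_
            contMDiffOn_invFun := ?_ }, ?_, ?_⟩
  · exact h4.comp (h1.mono fun y hy => by simp [Ψ] at hy; exact hy.1)
      (fun y hy => by simp [Ψ] at hy; exact hy.2)
  · exact h2.comp (h3.mono fun y hy => by simp [Ψ] at hy; exact hy.1)
      (fun y hy => by simp [Ψ] at hy; exact hy.2)
  · change x ∈ Ψ.source
    simp [Ψ, hc, hf.localInverseAt_symm]
  · intro y hy
    change f y = Ψ y
    change y ∈ Ψ.source at hy
    have hy1 : y ∈ (chartAt E x : OpenPartialHomeomorph X E).source := by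
      simp only [Ψ, OpenPartialHomeomorph.trans_source, mem_inter_iff] at hy; exact hy.1
    rw [hc] at hy1
    simp only [OpenPartialHomeomorph.trans_source, hf.localInverseAt_symm, mem_inter_iff,
      mem_preimage] at hy1
    change f y = (chartAt E (f x)).symm ((chartAt E x : OpenPartialHomeomorph X E) y)
    rw [hc, OpenPartialHomeomorph.coe_trans, Function.comp_apply, hf.localInverseAt_symm,
      (chartAt E (f x)).left_inv hy1.2]

end Pullback

/-- A continuous map into the source of a local diffeomorphism `f` is smooth as soon as its
composition with `f` is. -/
theorem contMDiffWithinAt_of_comp {EX EY EZ : Type*}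
    [NormedAddCommGroup EX] [NormedSpace ℝ EX] [NormedAddCommGroup EY] [NormedSpace ℝ EY]
    [NormedAddCommGroup EZ] [NormedSpace ℝ EZ] {HZ : Type*} [TopologicalSpace HZ]
    {J : ModelWithCorners ℝ EZ HZ}
    {X Y Z : Type*} [TopologicalSpace X] [ChartedSpace EX X] [TopologicalSpace Y]
    [ChartedSpace EY Y] [TopologicalSpace Z] [ChartedSpace HZ Z]
    {f : X → Y} (hf : IsLocalDiffeomorph 𝓘(ℝ, EX) 𝓘(ℝ, EY) ∞ f) {g : Z → X} {s : Set Z} {z : Z}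
    (hg : ContinuousWithinAt g s z)
    (hfg : ContMDiffWithinAt J 𝓘(ℝ, EY) ∞ (fun z => f (g z)) s z) (hz : z ∈ s) :
    ContMDiffWithinAt J 𝓘(ℝ, EX) ∞ g s z := by
  have h1 := (hf (g z)).localInverse_contMDiffAt.comp_contMDiffWithinAt z hfg
  refine h1.congr_of_eventuallyEq_of_mem ?_ hz
  have h2 := hg.eventually ((hf (g z)).localInverse.open_target.mem_nhds
    (hf (g z)).localInverse_mem_target)
  filter_upwards [h2] with y hy
  exact ((hf (g z)).localInverse_left_inv hy).symm

section Bundles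

variable (EM EG EP : Type*)
  [NormedAddCommGroup EM] [NormedSpace ℝ EM]
  [NormedAddCommGroup EG] [NormedSpace ℝ EG]
  [NormedAddCommGroup EP] [NormedSpace ℝ EP]
  (M M' : Type u) [TopologicalSpace M] [ChartedSpace EM M]
  [TopologicalSpace M'] [ChartedSpace EM M']
  (G : Type*) [TopologicalSpace G] [ChartedSpace EG G] [Group G]
  (P : Type u) [TopologicalSpace P] [ChartedSpace EP P] [MulAction G P]

/-- A smooth principal bundle `P(M, G)`, with `G` acting smoothly from the left on the total space
`P`: near every point of `M` there is a smooth local trivialization `p⁻¹(U) ≃ U × G` which carries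
the action of `G` to left translation of the second factor. -/
structure PrincipalBundle where
  /-- the projection `p : P → M` -/
  proj : P → M
  contMDiff_proj : ContMDiff 𝓘(ℝ, EP) 𝓘(ℝ, EM) ∞ proj
  contMDiff_smul : ContMDiff (𝓘(ℝ, EG).prod 𝓘(ℝ, EP)) 𝓘(ℝ, EP) ∞ fun a : G × P => a.1 • a.2
  proj_smul : ∀ (g : G) (u : P), proj (g • u) = proj u
  locally_trivial : ∀ x : M, ∃ e : Bundle.Trivialization G proj, x ∈ e.baseSet ∧
    ContMDiffOn 𝓘(ℝ, EP) (𝓘(ℝ, EM).prod 𝓘(ℝ, EG)) ∞ e (proj ⁻¹' e.baseSet) ∧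
    ContMDiffOn (𝓘(ℝ, EM).prod 𝓘(ℝ, EG)) 𝓘(ℝ, EP) ∞ e.toOpenPartialHomeomorph.symm
      (e.baseSet ×ˢ univ) ∧
    ∀ u : P, proj u ∈ e.baseSet → ∀ g : G, (e (g • u)).2 = g * (e u).2

/-- A smooth covering `q : M' → M`. -/
structure SmoothCovering where
  /-- the covering projection -/
  toFun : M' → M
  isCoveringMap : IsCoveringMap toFun
  isLocalDiffeomorph : IsLocalDiffeomorph 𝓘(ℝ, EM) 𝓘(ℝ, EM) ∞ toFun

end Bundles

variable {EM EG EP : Type*}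
  [NormedAddCommGroup EM] [NormedSpace ℝ EM]
  [NormedAddCommGroup EG] [NormedSpace ℝ EG]
  [NormedAddCommGroup EP] [NormedSpace ℝ EP]
  {M M' : Type u} [TopologicalSpace M] [ChartedSpace EM M]
  [TopologicalSpace M'] [ChartedSpace EM M']
  {G : Type*} [TopologicalSpace G] [ChartedSpace EG G] [Group G]
  {P : Type u} [TopologicalSpace P] [ChartedSpace EP P] [MulAction G P]

/-- The covering projection as a continuous map. -/
def SmoothCovering.toContinuousMap (q : SmoothCovering EM M M') : C(M', M) :=
  ⟨q.toFun, q.isCoveringMap.continuous⟩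

/-- The subgroup `q_#(π₁(M', m'))` of `π₁(M, m)`, where `q m' = m`. -/
def SmoothCovering.pi1 (q : SmoothCovering EM M M') {m' : M'} {m : M} (h : q.toFun m' = m) :
    Subgroup (FundamentalGroup M m) :=
  (FundamentalGroup.mapOfEq q.toContinuousMap h).range

/-- A covering is regular if the image of the fundamental group of the covering space is a normal
subgroup of the fundamental group of the base. -/
def SmoothCovering.IsRegular (q : SmoothCovering EM M M') : Prop :=
  ∀ m' : M', (q.pi1 (rfl : q.toFun m' = q.toFun m')).Normal

namespace PrincipalBundle

variable (B : PrincipalBundle EM EG EP M G P) (q : SmoothCovering EM M M')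

/-- The total space `P' = {(m, u) ∈ M' × P | q m = p u}` of the bundle induced by `q`. -/
structure InducedSpace where
  /-- the base point in `M'` -/
  base : M'
  /-- the point of `P` -/
  point : P
  compat : q.toFun base = B.proj point

instance : TopologicalSpace (B.InducedSpace q) :=
  TopologicalSpace.induced (fun z => (z.base, z.point)) inferInstance

variable {q}

/-- The projection `P' → M'` of the induced bundle. -/
def inducedProj (z : B.InducedSpace q) : M' := z.base

/-- The bundle map `P' → P` covering `q : M' → M`. -/
def inducedMap (z : B.InducedSpace q) : P := z.point

theorem proj_inducedMap (z : B.InducedSpace q) :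
    q.toFun (B.inducedProj z) = B.proj (B.inducedMap z) := z.compat

theorem induced_ext {z w : B.InducedSpace q} (h₁ : B.inducedProj z = B.inducedProj w)
    (h₂ : B.inducedMap z = B.inducedMap w) : z = w := by
  cases z; cases w; cases h₁; cases h₂; rfl

theorem isInducing_induced :
    Topology.IsInducing fun z : B.InducedSpace q => (B.inducedProj z, B.inducedMap z) := ⟨rfl⟩

theorem continuous_inducedProj : Continuous (B.inducedProj (q := q)) :=
  continuous_fst.comp B.isInducing_induced.continuous

theorem continuous_inducedMap : Continuous (B.inducedMap (q := q)) :=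
  continuous_snd.comp B.isInducing_induced.continuous

theorem continuousOn_induced_iff {Z : Type*} [TopologicalSpace Z] {f : Z → B.InducedSpace q}
    {s : Set Z} : ContinuousOn f s ↔ ContinuousOn (fun z => B.inducedProj (f z)) s ∧
      ContinuousOn (fun z => B.inducedMap (f z)) s := by
  rw [B.isInducing_induced.continuousOn_iff]
  exact ⟨fun h => ⟨continuous_fst.comp_continuousOn h, continuous_snd.comp_continuousOn h⟩,
    fun h => h.1.prodMk h.2⟩

theorem isLocalHomeomorph_inducedMap : IsLocalHomeomorph (B.inducedMap (q := q)) := by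
  classical
  refine IsLocalHomeomorph.mk _ fun z => ?_
  obtain ⟨e, he, hqe⟩ := q.isCoveringMap.isLocalHomeomorph (B.inducedProj z)
  have hinv : ∀ u : P, B.proj u ∈ e.target → q.toFun (e.symm (B.proj u)) = B.proj u := by
    intro u hu
    rw [hqe, e.right_inv hu]
  refine ⟨{ toFun := B.inducedMap
            invFun := fun u => if h : B.proj u ∈ e.target then
              ⟨e.symm (B.proj u), u, hinv u h⟩ else z
            source := B.inducedProj ⁻¹' e.source
            target := B.proj ⁻¹' e.target
            map_source' := fun w hw => ?_
            map_target' := fun u hu => ?_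
            left_inv' := fun w hw => ?_
            right_inv' := fun u hu => ?_
            open_source := e.open_source.preimage B.continuous_inducedProj
            open_target := e.open_target.preimage B.contMDiff_proj.continuous
            continuousOn_toFun := B.continuous_inducedMap.continuousOn
            continuousOn_invFun := ?_ }, he, fun _ _ => rfl⟩
  · have := e.map_source hw
    rw [← hqe, B.proj_inducedMap] at this
    exact this
  · rw [mem_preimage] at hu
    simp only [dif_pos hu]
    exact e.map_target hu
  · have h1 := e.map_source hw
    rw [← hqe, B.proj_inducedMap] at h1
    simp only [dif_pos h1]
    refine B.induced_ext ?_ rfl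
    change e.symm (B.proj (B.inducedMap w)) = B.inducedProj w
    rw [← B.proj_inducedMap, hqe]
    exact e.left_inv hw
  · rw [mem_preimage] at hu
    simp only [dif_pos hu]
    rfl
  · refine (B.continuousOn_induced_iff).2 ⟨?_, ?_⟩
    · refine (e.continuousOn_symm.comp (s := B.proj ⁻¹' e.target)
        B.contMDiff_proj.continuous.continuousOn fun u hu => hu).congr fun u hu => ?_
      rw [mem_preimage] at hu
      simp only [dif_pos hu]
      rfl
    · refine continuousOn_id.congr fun u hu => ?_
      rw [mem_preimage] at hu
      simp only [dif_pos hu]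
      rfl

/-- The smooth structure of `P'` is the one for which `P' → P` is a local diffeomorphism. -/
instance : ChartedSpace EP (B.InducedSpace q) :=
  pullbackChartedSpace B.isLocalHomeomorph_inducedMap

instance [IsManifold 𝓘(ℝ, EP) ∞ P] : IsManifold 𝓘(ℝ, EP) ∞ (B.InducedSpace q) :=
  pullback_isManifold B.isLocalHomeomorph_inducedMap

theorem isLocalDiffeomorph_inducedMap [IsManifold 𝓘(ℝ, EP) ∞ P] :
    IsLocalDiffeomorph 𝓘(ℝ, EP) 𝓘(ℝ, EP) ∞ (B.inducedMap (q := q)) :=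
  pullback_isLocalDiffeomorph B.isLocalHomeomorph_inducedMap

/-- The action of `G` on `P'`. -/
instance : MulAction G (B.InducedSpace q) where
  smul g z := ⟨z.base, g • z.point, z.compat.trans (B.proj_smul g z.point).symm⟩
  one_smul z := B.induced_ext rfl (one_smul G z.point)
  mul_smul g h z := B.induced_ext rfl (mul_smul g h z.point)

theorem inducedMap_smul (g : G) (z : B.InducedSpace q) :
    B.inducedMap (g • z) = g • B.inducedMap z := rfl

theorem inducedProj_smul (g : G) (z : B.InducedSpace q) :
    B.inducedProj (g • z) = B.inducedProj z := rfl

theorem contMDiff_inducedProj [IsManifold 𝓘(ℝ, EP) ∞ P] :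
    ContMDiff 𝓘(ℝ, EP) 𝓘(ℝ, EM) ∞ (B.inducedProj (q := q)) := by
  intro z
  refine contMDiffWithinAt_of_comp q.isLocalDiffeomorph
    B.continuous_inducedProj.continuousWithinAt ?_ (mem_univ z)
  simp only [B.proj_inducedMap]
  exact (B.contMDiff_proj.comp B.isLocalDiffeomorph_inducedMap.contMDiff).contMDiffAt

theorem exists_proj_eq (x : M) : ∃ u : P, B.proj u = x := by
  obtain ⟨e, hx, -⟩ := B.locally_trivial x
  exact ⟨e.toOpenPartialHomeomorph.symm (x, 1), e.proj_symm_apply' hx⟩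

/-- The inverse `(m, g) ↦ (m, φ⁻¹(q m, g))` of a local trivialization of the induced bundle. -/
def inducedInv (e : Bundle.Trivialization G B.proj) (a : M' × G) : B.InducedSpace q :=
  open Classical in if h : q.toFun a.1 ∈ e.baseSet then
    ⟨a.1, e.toOpenPartialHomeomorph.symm (q.toFun a.1, a.2), (e.proj_symm_apply' h).symm⟩
  else ⟨a.1, (B.exists_proj_eq (q.toFun a.1)).choose,
    (B.exists_proj_eq (q.toFun a.1)).choose_spec.symm⟩

theorem inducedProj_inducedInv (e : Bundle.Trivialization G B.proj) (a : M' × G) :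
    B.inducedProj (B.inducedInv (q := q) e a) = a.1 := by
  unfold inducedInv
  split_ifs <;> rfl

theorem inducedMap_inducedInv (e : Bundle.Trivialization G B.proj) {a : M' × G}
    (h : q.toFun a.1 ∈ e.baseSet) : B.inducedMap (B.inducedInv (q := q) e a) =
      e.toOpenPartialHomeomorph.symm (q.toFun a.1, a.2) := by
  unfold inducedInv
  rw [dif_pos h]
  rfl

theorem continuousOn_inducedInv (e : Bundle.Trivialization G B.proj) :
    ContinuousOn (B.inducedInv (q := q) e) ((q.toFun ⁻¹' e.baseSet) ×ˢ univ) := by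
  refine B.continuousOn_induced_iff.2 ⟨?_, ?_⟩
  · simp only [inducedProj_inducedInv]
    exact continuous_fst.continuousOn
  · refine ContinuousOn.congr (f := fun a : M' × G =>
      e.toOpenPartialHomeomorph.symm (q.toFun a.1, a.2)) ?_
      fun a ha => B.inducedMap_inducedInv e ha.1
    refine e.continuousOn_invFun.comp (((q.isCoveringMap.continuous.comp
      continuous_fst).prodMk continuous_snd).continuousOn) fun a ha => ?_
    rw [e.target_eq]
    exact ⟨ha.1, mem_univ _⟩

/-- The local trivialization `(m, u) ↦ (m, φ u)` of the induced bundle obtained from a local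
trivialization `u ↦ (p u, φ u)` of the given bundle. -/
def inducedTrivialization (e : Bundle.Trivialization G B.proj) :
    Bundle.Trivialization G (B.inducedProj (q := q)) where
  toFun z := (B.inducedProj z, (e (B.inducedMap z)).2)
  invFun := B.inducedInv e
  source := B.inducedProj ⁻¹' (q.toFun ⁻¹' e.baseSet)
  target := (q.toFun ⁻¹' e.baseSet) ×ˢ univ
  baseSet := q.toFun ⁻¹' e.baseSet
  map_source' z hz := ⟨hz, mem_univ _⟩
  map_target' a ha := by
    rw [mem_preimage, inducedProj_inducedInv]
    exact ha.1
  left_inv' z hz := by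
    refine B.induced_ext (B.inducedProj_inducedInv e _) ?_
    rw [B.inducedMap_inducedInv e (by exact hz), B.proj_inducedMap]
    rw [mem_preimage, mem_preimage, B.proj_inducedMap] at hz
    exact e.symm_apply_mk_proj (e.mem_source.2 hz)
  right_inv' a ha := by
    refine Prod.ext (B.inducedProj_inducedInv e a) ?_
    change (e (B.inducedMap (B.inducedInv e a))).2 = a.2
    rw [B.inducedMap_inducedInv e ha.1, e.apply_symm_apply' ha.1]
  open_source := (e.open_baseSet.preimage q.isCoveringMap.continuous).preimage
    B.continuous_inducedProj
  open_target := (e.open_baseSet.preimage q.isCoveringMap.continuous).prod isOpen_univ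
  continuousOn_toFun := by
    refine B.continuous_inducedProj.continuousOn.prodMk (continuous_snd.comp_continuousOn
      (e.continuousOn_toFun.comp B.continuous_inducedMap.continuousOn fun z hz => ?_))
    rw [mem_preimage, mem_preimage, B.proj_inducedMap] at hz
    exact e.mem_source.2 hz
  continuousOn_invFun := B.continuousOn_inducedInv e
  open_baseSet := e.open_baseSet.preimage q.isCoveringMap.continuous
  source_eq := rfl
  target_eq := rfl
  proj_toFun _ _ := rfl

variable (q) in
/-- The principal bundle `P'(M', G)` induced over the covering `q : M' → M`. -/
def induced [IsManifold 𝓘(ℝ, EP) ∞ P] : PrincipalBundle EM EG EP M' G (B.InducedSpace q) where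
  proj := B.inducedProj
  contMDiff_proj := B.contMDiff_inducedProj
  contMDiff_smul := by
    intro a
    have hs : ContMDiff (𝓘(ℝ, EG).prod 𝓘(ℝ, EP)) 𝓘(ℝ, EP) ∞
        fun a : G × B.InducedSpace q => a.1 • B.inducedMap a.2 :=
      B.contMDiff_smul.comp (contMDiff_fst.prodMk
        (B.isLocalDiffeomorph_inducedMap.contMDiff.comp contMDiff_snd))
    refine contMDiffWithinAt_of_comp B.isLocalDiffeomorph_inducedMap ?_ (hs a) (mem_univ a)
    refine (B.continuousOn_induced_iff.2 ⟨?_, ?_⟩).continuousWithinAt (mem_univ a)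
    · exact (B.continuous_inducedProj.comp continuous_snd).continuousOn
    · exact hs.continuous.continuousOn
  proj_smul := B.inducedProj_smul
  locally_trivial x := by
    obtain ⟨e, hx, h1, h2, h3⟩ := B.locally_trivial (q.toFun x)
    refine ⟨B.inducedTrivialization e, hx, ?_, ?_, fun z hz g => ?_⟩
    · refine B.contMDiff_inducedProj.contMDiffOn.prodMk (contMDiff_snd.comp_contMDiffOn
        (h1.comp B.isLocalDiffeomorph_inducedMap.contMDiff.contMDiffOn fun z hz => ?_))
      have hz' : q.toFun (B.inducedProj z) ∈ e.baseSet := hz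
      rw [B.proj_inducedMap] at hz'
      exact hz'
    · intro a ha
      have ha' : q.toFun a.1 ∈ e.baseSet := ha.1
      refine contMDiffWithinAt_of_comp B.isLocalDiffeomorph_inducedMap
        (B.continuousOn_inducedInv e a ha) ?_ ha
      refine ContMDiffOn.congr (f := fun a : M' × G =>
        e.toOpenPartialHomeomorph.symm (q.toFun a.1, a.2)) ?_
        (fun b hb => B.inducedMap_inducedInv e hb.1) a ha
      exact h2.comp ((q.isLocalDiffeomorph.contMDiff.comp contMDiff_fst).prodMk
        contMDiff_snd).contMDiffOn fun b hb => ⟨hb.1, mem_univ _⟩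
    · have hz' : q.toFun (B.inducedProj z) ∈ e.baseSet := hz
      rw [B.proj_inducedMap] at hz'
      exact h3 _ hz' g

/-! ### Connections -/

/-- A connection form on `P(M, G)`: a smooth 1-form `ω` on `P` with values in the Lie algebra of
`G` such that `ω(A*) = A` for the fundamental vector field `A*` of every `A` in the Lie algebra,
and `ω ((L_g)_* v) = Ad(g) (ω v)` for every `g` in `G`, where `L_g u = g • u`. -/
structure Connection [IsManifold 𝓘(ℝ, EP) ∞ P] (B : PrincipalBundle EM EG EP M G P) where
  /-- the connection form -/
  form : ∀ u : P, TangentSpace 𝓘(ℝ, EP) u →L[ℝ] GroupLieAlgebra 𝓘(ℝ, EG) G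
  contMDiff_form : ContMDiff (M' := EG) 𝓘(ℝ, EP).tangent 𝓘(ℝ, EG) ∞
    fun v : TangentBundle 𝓘(ℝ, EP) P => form v.1 v.2
  form_fundamental : ∀ (u : P) (A : GroupLieAlgebra 𝓘(ℝ, EG) G),
    form u (mfderiv 𝓘(ℝ, EG) 𝓘(ℝ, EP) (fun g : G => g • u) 1 A) = A
  form_smul : ∀ (g : G) (u : P) (v : TangentSpace 𝓘(ℝ, EP) u),
    form (g • u) (mfderiv 𝓘(ℝ, EP) 𝓘(ℝ, EP) (fun w : P => g • w) u v) =
      mfderiv 𝓘(ℝ, EG) 𝓘(ℝ, EG) (fun h : G => g * h * g⁻¹) 1 (form u v)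

namespace Connection

variable [IsManifold 𝓘(ℝ, EP) ∞ P] {B} (Γ : B.Connection)

variable (q) in
/-- The connection on the induced bundle `P'(M', G)`: its form is the pullback of the connection
form on `P` under the bundle map `P' → P`. -/
def induced [LieGroup 𝓘(ℝ, EG) ∞ G] : (B.induced q).Connection where
  form z := (Γ.form (B.inducedMap z)).comp (mfderiv 𝓘(ℝ, EP) 𝓘(ℝ, EP) B.inducedMap z)
  contMDiff_form := Γ.contMDiff_form.comp
    (B.isLocalDiffeomorph_inducedMap.contMDiff.contMDiff_tangentMap (m := ∞) (by simp))
  form_fundamental z A := by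
    have hd : ∀ w : B.InducedSpace q, MDifferentiableAt 𝓘(ℝ, EP) 𝓘(ℝ, EP) B.inducedMap w :=
      B.isLocalDiffeomorph_inducedMap.mdifferentiable (by simp)
    have ha : MDifferentiableAt 𝓘(ℝ, EG) 𝓘(ℝ, EP) (fun g : G => g • z) 1 :=
      (((B.induced q).contMDiff_smul.comp (contMDiff_id.prodMk contMDiff_const)).mdifferentiable
        (by simp)) 1
    have key : ∀ w : B.InducedSpace q, w = z → ∀ a : EP,
        (mfderiv 𝓘(ℝ, EP) 𝓘(ℝ, EP) B.inducedMap w a : EP) =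
          mfderiv 𝓘(ℝ, EP) 𝓘(ℝ, EP) B.inducedMap z a := by
      rintro _ rfl _; rfl
    have hc := mfderiv_comp (1 : G) (hd ((1 : G) • z)) ha
    have hA : (mfderiv 𝓘(ℝ, EG) 𝓘(ℝ, EP) (fun g : G => g • B.inducedMap z) 1 A : EP) =
        mfderiv 𝓘(ℝ, EP) 𝓘(ℝ, EP) B.inducedMap z
          (mfderiv 𝓘(ℝ, EG) 𝓘(ℝ, EP) (fun g : G => g • z) 1 A) :=
      (congrArg (fun L : EG →L[ℝ] EP => L A) hc).trans (key _ (one_smul G z) _)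
    exact (congrArg (Γ.form (B.inducedMap z)) hA.symm).trans
      (Γ.form_fundamental (B.inducedMap z) A)
  form_smul g z v := by
    have hd : ∀ w : B.InducedSpace q, MDifferentiableAt 𝓘(ℝ, EP) 𝓘(ℝ, EP) B.inducedMap w :=
      B.isLocalDiffeomorph_inducedMap.mdifferentiable (by simp)
    have ha : MDifferentiableAt 𝓘(ℝ, EP) 𝓘(ℝ, EP) (fun w : B.InducedSpace q => g • w) z :=
      (((B.induced q).contMDiff_smul.comp (contMDiff_const.prodMk contMDiff_id)).mdifferentiable
        (by simp)) z
    have hb : MDifferentiableAt 𝓘(ℝ, EP) 𝓘(ℝ, EP) (fun w : P => g • w) (B.inducedMap z) :=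
      ((B.contMDiff_smul.comp (contMDiff_const.prodMk contMDiff_id)).mdifferentiable
        (by simp)) _
    have h1 := mfderiv_comp z (hd (g • z)) ha
    have h2 := mfderiv_comp z hb (hd z)
    have h3 := congrArg (fun L : EP →L[ℝ] EP => L v) (h1.symm.trans h2)
    exact (congrArg (Γ.form (g • B.inducedMap z)) h3).trans
      (Γ.form_smul g (B.inducedMap z) (mfderiv 𝓘(ℝ, EP) 𝓘(ℝ, EP) B.inducedMap z v))

/-- `s` is a smooth horizontal section of `P(M, G)` over the open set `U`: it satisfies `p ∘ s = id`
and `s^* ω = 0`. -/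
structure IsHorizontalSection (U : Set M) (s : M → P) : Prop where
  isOpen : IsOpen U
  contMDiffOn : ContMDiffOn 𝓘(ℝ, EM) 𝓘(ℝ, EP) ∞ s U
  proj_eq : ∀ x ∈ U, B.proj (s x) = x
  horizontal : ∀ x ∈ U, ∀ v : TangentSpace 𝓘(ℝ, EM) x,
    Γ.form (s x) (mfderiv 𝓘(ℝ, EM) 𝓘(ℝ, EP) s x v) = 0

/-- A connection is flat if every point of `M` has an open neighbourhood `U` over which it is
isomorphic to the product connection on `U × G`. Such an isomorphism `(x, g) ↦ g • s x` is the same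
as a horizontal section `s` over `U`. -/
def IsFlat : Prop := ∀ x : M, ∃ (U : Set M) (s : M → P), x ∈ U ∧ Γ.IsHorizontalSection U s

/-- A continuous path in `P` is horizontal for a flat connection if near every time it runs in the
image of a horizontal section. (For a `C^1` path `z` this means `ω(z') = 0`.) -/
def IsHorizontalPath {a b : P} (z : Path a b) : Prop :=
  ∀ t : unitInterval, ∃ (U : Set M) (s : M → P), Γ.IsHorizontalSection U s ∧
    ∀ᶠ t' in 𝓝 t, B.proj (z t') ∈ U ∧ z t' = s (B.proj (z t'))

/-- The holonomy morphism `h : π₁(M, p x₀) → G` of a flat connection: `h [w]` is the unique `g`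
such that the horizontal lift of the loop `w` which starts at `x₀` ends at `g • x₀`. -/
def holonomy (x₀ : P) (c : FundamentalGroup M (B.proj x₀)) : G :=
  Classical.epsilon fun g : G => ∃ z : Path x₀ (g • x₀), Γ.IsHorizontalPath z ∧
    Path.Homotopic.Quotient.mk
      ((z.map B.contMDiff_proj.continuous).cast rfl (B.proj_smul g x₀).symm) = c

/-- The total space of the holonomy bundle through `x₀`: the set of all points which can be joined
to `x₀` by a horizontal path. -/
def holonomyBundle (x₀ : P) : Set P := {u | ∃ z : Path x₀ u, Γ.IsHorizontalPath z}

/-- `i : L → P` is an (injectively immersed) integral manifold of the horizontal distribution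
`ker ω`. -/
structure IsIntegralManifold {L : Type u} [TopologicalSpace L] [ChartedSpace EM L]
    (i : L → P) : Prop where
  contMDiff : ContMDiff 𝓘(ℝ, EM) 𝓘(ℝ, EP) ∞ i
  injective : Function.Injective i
  mfderiv_injective : ∀ y : L, Function.Injective (mfderiv 𝓘(ℝ, EM) 𝓘(ℝ, EP) i y)
  mfderiv_range : ∀ (y : L) (w : TangentSpace 𝓘(ℝ, EP) (i y)),
    (∃ v : TangentSpace 𝓘(ℝ, EM) y, mfderiv 𝓘(ℝ, EM) 𝓘(ℝ, EP) i y v = w) ↔ Γ.form (i y) w = 0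

/-- `i : N → P` is the maximal horizontal leaf through `x₀`: a connected integral manifold through
`x₀` which contains every other connected integral manifold through `x₀` (smoothly). -/
structure IsMaximalLeaf (x₀ : P) {N : Type u} [TopologicalSpace N] [ChartedSpace EM N]
    (i : N → P) : Prop where
  isManifold : IsManifold 𝓘(ℝ, EM) ∞ N
  connected : ConnectedSpace N
  integral : Γ.IsIntegralManifold i
  mem_range : x₀ ∈ range i
  maximal : ∀ (L : Type u) [TopologicalSpace L] [ChartedSpace EM L] [IsManifold 𝓘(ℝ, EM) ∞ L]
    [ConnectedSpace L] (j : L → P), Γ.IsIntegralManifold j → x₀ ∈ range j →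
    ∃ f : L → N, ContMDiff 𝓘(ℝ, EM) 𝓘(ℝ, EM) ∞ f ∧ ∀ y, i (f y) = j y

end Connection

end PrincipalBundle

end FlatCovering

end

/-! Flatness makes horizontality a locally discrete matter. Over a small open set every point of the
bundle is `u = γ u • s (p u)` for a horizontal section `s`. Applying the connection form to the
derivative of this product shows that `γ ∘ f` has zero derivative for every horizontal map `f`, so
`f` stays locally in a translate of `s` (`eventually_eq_comp_proj`). Hence horizontal sections that
meet agree nearby, and their images are the open sheets of a finer topology on `P`. With this
topology (`LeafSpace`), `P` is a covering of `M` on which `G` permutes the sheets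
(`isQuotientCoveringMap_proj`).

Horizontal paths are precisely the paths of the leaf space, so a holonomy bundle is a path component
of it. That component is smooth because it projects to `M` by a local homeomorphism. Every integral
manifold is continuous for the leaf topology, so the component is the maximal leaf
(`isMaximalLeaf_incl`).

A leaf path of the induced bundle amounts to a leaf path of `P` together with a lift of its
projection to `M'`. Path lifting therefore makes the bundle map surjective between holonomy bundles.
Injectivity is where the kernel enters: two leaf paths upstairs from `x₀'` that end over the same
point of `P` give a loop in the leaf space of `P`. Its class in `π₁(M)` has trivial holonomy, hence
comes from `π₁(M')` and lifts to a closed loop, so the two endpoints have the same base point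
(`bijOn_holonomyBundle`). Both leaves are locally diffeomorphic to `M`, so this bijection is a
diffeomorphism. -/

noncomputable section

namespace FlatCovering

/-! ### Local constancy from a vanishing derivative -/

/-- A map between manifolds whose derivative vanishes near a point is constant near that point. -/
theorem eventually_eq_of_mfderiv_eq_zero {EX EY : Type*}
    [NormedAddCommGroup EX] [NormedSpace ℝ EX] [NormedAddCommGroup EY] [NormedSpace ℝ EY]
    {X Y : Type*} [TopologicalSpace X] [ChartedSpace EX X] [IsManifold 𝓘(ℝ, EX) ∞ X]
    [TopologicalSpace Y] [ChartedSpace EY Y] [IsManifold 𝓘(ℝ, EY) ∞ Y] {f : X → Y} {x : X}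
    (h : ∀ᶠ x' in 𝓝 x, MDifferentiableAt 𝓘(ℝ, EX) 𝓘(ℝ, EY) f x' ∧
      ∀ v, mfderiv 𝓘(ℝ, EX) 𝓘(ℝ, EY) f x' v = 0) :
    ∀ᶠ x' in 𝓝 x, f x' = f x := by
  have : IsManifold 𝓘(ℝ, EX) 1 X := IsManifold.of_le (n := ∞) (by simp)
  have : IsManifold 𝓘(ℝ, EY) 1 Y := IsManifold.of_le (n := ∞) (by simp)
  have hc : ContinuousAt f x := h.self_of_nhds.1.continuousAt
  -- `W` is mapped into a single chart of `Y`, so that `f` can be read in charts on all of it.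
  obtain ⟨W, hW, hWo, hxW⟩ := eventually_nhds_iff.1
    (h.and (hc.eventually ((chartAt EY (f x)).open_source.mem_nhds (mem_chart_source EY (f x)))))
  set e := chartAt EX x
  set e' := chartAt EY (f x)
  set F : EX → EY := fun z => e' (f (e.symm z)) with hF
  have hO : IsOpen (e.target ∩ e.symm ⁻¹' W) := e.isOpen_inter_preimage_symm hWo
  have hd : ∀ z ∈ e.target ∩ e.symm ⁻¹' W, HasMFDerivAt 𝓘(ℝ, EX) 𝓘(ℝ, EY) F z
      (0 : EX →L[ℝ] EY) := by
    rintro z ⟨hz, hzW⟩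
    have h1 : MDifferentiableAt 𝓘(ℝ, EX) 𝓘(ℝ, EX) e.symm z :=
      mdifferentiableAt_atlas_symm (I := 𝓘(ℝ, EX)) (chart_mem_atlas EX x) hz
    have h2 := (hW _ hzW).1.1
    have h3 : MDifferentiableAt 𝓘(ℝ, EY) 𝓘(ℝ, EY) e' (f (e.symm z)) :=
      mdifferentiableAt_atlas (I := 𝓘(ℝ, EY)) (chart_mem_atlas EY (f x)) (hW _ hzW).2
    have h4 := h3.hasMFDerivAt.comp z (h2.hasMFDerivAt.comp z h1.hasMFDerivAt)
    refine h4.congr_mfderiv ?_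
    ext v
    have h5 := (hW _ hzW).1.2 (mfderiv 𝓘(ℝ, EX) 𝓘(ℝ, EX) e.symm z v)
    exact (congrArg (mfderiv 𝓘(ℝ, EY) 𝓘(ℝ, EY) e' (f (e.symm z))) h5).trans (map_zero _)
  have hd' : ∀ z ∈ e.target ∩ e.symm ⁻¹' W, HasFDerivAt F (0 : EX →L[ℝ] EY) z := fun z hz =>
    hasMFDerivAt_iff_hasFDerivAt.1 (hd z hz)
  -- In charts the derivative is zero on an open set, so the level set of `F` through `e x` is open.
  have hopen := hO.isOpen_inter_preimage_of_fderiv_eq_zero (𝕜 := ℝ)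
    (fun z hz => (hd' z hz).differentiableAt.differentiableWithinAt)
    (fun z hz => (hd' z hz).fderiv) {F (e x)}
  have hx : x ∈ e.source := mem_chart_source EX x
  have hmem : e x ∈ (e.target ∩ e.symm ⁻¹' W) ∩ F ⁻¹' {F (e x)} :=
    ⟨⟨e.map_source hx, by rw [mem_preimage, e.left_inv hx]; exact hxW⟩, rfl⟩
  filter_upwards [(e.continuousAt hx).eventually (hopen.mem_nhds hmem),
    e.open_source.mem_nhds hx] with y hy hys
  obtain ⟨⟨-, hyW⟩, hyF⟩ := hy
  rw [mem_preimage, e.left_inv hys] at hyW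
  rw [mem_preimage, mem_singleton_iff, hF] at hyF
  simp only [e.left_inv hys, e.left_inv hx] at hyF
  exact e'.injOn (hW y hyW).2 (mem_chart_source EY (f x)) hyF

variable {EM EG EP EX : Type*}
  [NormedAddCommGroup EM] [NormedSpace ℝ EM]
  [NormedAddCommGroup EG] [NormedSpace ℝ EG]
  [NormedAddCommGroup EP] [NormedSpace ℝ EP]
  [NormedAddCommGroup EX] [NormedSpace ℝ EX]
  {M : Type u} [TopologicalSpace M] [ChartedSpace EM M]
  {G : Type*} [TopologicalSpace G] [ChartedSpace EG G] [Group G]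
  {P : Type u} [TopologicalSpace P] [ChartedSpace EP P] [MulAction G P]
  {X : Type*} [TopologicalSpace X] [ChartedSpace EX X]

/-! ### The group action on fibres and the product rule -/

namespace PrincipalBundle

/-- In a local trivialization the action is left translation of `G`, which is free. -/
theorem eq_one_of_smul_eq (B : PrincipalBundle EM EG EP M G P) {g : G} {u : P} (h : g • u = u) :
    g = 1 := by
  obtain ⟨e, hx, -, -, h3⟩ := B.locally_trivial (B.proj u)
  have := h3 u hx g
  rw [h] at this
  exact right_eq_mul.1 this

/-- The quotient of the two fibre coordinates in a local trivialization is the required group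
element. -/
theorem exists_smul_eq (B : PrincipalBundle EM EG EP M G P) {u v : P} (h : B.proj u = B.proj v) :
    ∃ g : G, g • v = u := by
  obtain ⟨e, hx, -, -, h3⟩ := B.locally_trivial (B.proj v)
  have hv : B.proj (((e u).2 * (e v).2⁻¹) • v) = B.proj v := B.proj_smul _ _
  refine ⟨(e u).2 * (e v).2⁻¹, ?_⟩
  refine e.injOn (e.mem_source.2 (hv ▸ hx)) (e.mem_source.2 (h ▸ hx)) ?_
  refine Prod.ext ?_ ?_
  · exact ((e.coe_fst' (hv ▸ hx)).trans (hv.trans h.symm)).trans (e.coe_fst' (h ▸ hx)).symm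
  · refine (h3 v hx _).trans ?_
    simp

theorem contMDiff_const_smul (B : PrincipalBundle EM EG EP M G P) (g : G) :
    ContMDiff 𝓘(ℝ, EP) 𝓘(ℝ, EP) ∞ fun u : P => g • u :=
  B.contMDiff_smul.comp (contMDiff_const.prodMk contMDiff_id)

/-- The product rule for a map `f = κ • (σ ∘ c)` into a principal bundle. -/
theorem mfderiv_smul_comp (B : PrincipalBundle EM EG EP M G P) {f : X → P} {κ : X → G} {c : X → M}
    {σ : M → P} {x : X} (hκ : MDifferentiableAt 𝓘(ℝ, EX) 𝓘(ℝ, EG) κ x)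
    (hc : MDifferentiableAt 𝓘(ℝ, EX) 𝓘(ℝ, EM) c x)
    (hσ : MDifferentiableAt 𝓘(ℝ, EM) 𝓘(ℝ, EP) σ (c x))
    (hf : f =ᶠ[𝓝 x] fun x' => κ x' • σ (c x')) (h1 : κ x = 1) (v : EX) :
    (mfderiv 𝓘(ℝ, EX) 𝓘(ℝ, EP) f x v : EP) = @HAdd.hAdd EP EP EP _
      (mfderiv 𝓘(ℝ, EG) 𝓘(ℝ, EP) (fun g : G => g • σ (c x)) 1
        (mfderiv 𝓘(ℝ, EX) 𝓘(ℝ, EG) κ x v : EG))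
      (mfderiv 𝓘(ℝ, EM) 𝓘(ℝ, EP) σ (c x) (mfderiv 𝓘(ℝ, EX) 𝓘(ℝ, EM) c x v)) := by
  have hF : MDifferentiableAt (𝓘(ℝ, EG).prod 𝓘(ℝ, EM)) 𝓘(ℝ, EP)
      (fun a : G × M => a.1 • σ a.2) (κ x, c x) := by
    refine MDifferentiableAt.comp (I' := 𝓘(ℝ, EG).prod 𝓘(ℝ, EP)) (g := fun a : G × P => a.1 • a.2)
      (f := fun a : G × M => (a.1, σ a.2)) (κ x, c x)
      (B.contMDiff_smul.mdifferentiableAt (by simp)) ?_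
    exact mdifferentiableAt_fst.prodMk (hσ.comp (κ x, c x) mdifferentiableAt_snd)
  have hp : MDifferentiableAt 𝓘(ℝ, EX) (𝓘(ℝ, EG).prod 𝓘(ℝ, EM)) (fun x => (κ x, c x)) x :=
    hκ.prodMk hc
  have h2 := hf.mfderiv_eq (I := 𝓘(ℝ, EX)) (I' := 𝓘(ℝ, EP))
  have h3 := mfderiv_comp x hF hp
  have h4 := mfderiv_prod_eq_add_apply
    (v := mfderiv 𝓘(ℝ, EX) (𝓘(ℝ, EG).prod 𝓘(ℝ, EM)) (fun x => (κ x, c x)) x v) hF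
  have h5 := hκ.mfderiv_prod hc
  -- Since `κ x = 1`, the partial map in the second variable is `σ` itself, and the first partial
  -- derivative is taken at the identity, where fundamental vectors are defined.
  have h6 : (fun m : M => κ x • σ m) = σ := by ext m; rw [h1, one_smul]
  -- The terms lie in tangent spaces at equal points that are written differently, so the identity
  -- is stated in the model space `EP`.
  have h7 : (mfderiv 𝓘(ℝ, EX) 𝓘(ℝ, EP) f x v : EP) =
      mfderiv (𝓘(ℝ, EG).prod 𝓘(ℝ, EM)) 𝓘(ℝ, EP) (fun a : G × M => a.1 • σ a.2) (κ x, c x)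
        (mfderiv 𝓘(ℝ, EX) (𝓘(ℝ, EG).prod 𝓘(ℝ, EM)) (fun x => (κ x, c x)) x v) :=
    congrArg (fun L : EX →L[ℝ] EP => L v) (h2.trans h3)
  refine h7.trans (h4.trans ?_)
  rw [h5]
  rw [← h1]
  exact congrArg₂ (fun a b : EP => a + b) rfl
    (congrArg (fun τ : M → P => (mfderiv 𝓘(ℝ, EM) 𝓘(ℝ, EP) τ (c x)
      (mfderiv 𝓘(ℝ, EX) 𝓘(ℝ, EM) c x v) : EP)) h6)

namespace Connection

variable [IsManifold 𝓘(ℝ, EP) ∞ P] {B : PrincipalBundle EM EG EP M G P} {Γ : B.Connection}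
  {U V : Set M} {s s' : M → P} {x : M}

/-! ### Horizontal sections and their local uniqueness -/

namespace IsHorizontalSection

theorem contMDiffAt (hs : Γ.IsHorizontalSection U s) (hx : x ∈ U) :
    ContMDiffAt 𝓘(ℝ, EM) 𝓘(ℝ, EP) ∞ s x :=
  hs.contMDiffOn.contMDiffAt (hs.isOpen.mem_nhds hx)

theorem mdifferentiableAt (hs : Γ.IsHorizontalSection U s) (hx : x ∈ U) :
    MDifferentiableAt 𝓘(ℝ, EM) 𝓘(ℝ, EP) s x :=
  (hs.contMDiffAt hx).mdifferentiableAt (by simp)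

/-- The form changes by the linear map `Ad g` under translation, so translation preserves its
kernel. -/
theorem smul (hs : Γ.IsHorizontalSection U s) (g : G) :
    Γ.IsHorizontalSection U fun x => g • s x where
  isOpen := hs.isOpen
  contMDiffOn := (B.contMDiff_const_smul g).comp_contMDiffOn hs.contMDiffOn
  proj_eq x hx := (B.proj_smul g _).trans (hs.proj_eq x hx)
  horizontal x hx v := by
    have h1 := mfderiv_comp x ((B.contMDiff_const_smul g).mdifferentiableAt (by simp))
      (hs.mdifferentiableAt hx)
    have h2 := congrArg (fun L : EM →L[ℝ] EP => L v) h1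
    refine (congrArg (Γ.form (g • s x)) h2).trans ((Γ.form_smul g (s x) _).trans ?_)
    exact (congrArg (mfderiv 𝓘(ℝ, EG) 𝓘(ℝ, EG) (fun h : G => g * h * g⁻¹) 1)
      (hs.horizontal x hx v)).trans (map_zero _)

/-- Near a point of its domain, a horizontal section identifies the bundle with a product. -/
theorem exists_difference [LieGroup 𝓘(ℝ, EG) ∞ G] (hs : Γ.IsHorizontalSection U s) (hx : x ∈ U) :
    ∃ (V : Set M) (γ : P → G), IsOpen V ∧ x ∈ V ∧ V ⊆ U ∧
      ContMDiffOn 𝓘(ℝ, EP) 𝓘(ℝ, EG) ∞ γ (B.proj ⁻¹' V) ∧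
      ∀ u, B.proj u ∈ V → γ u • s (B.proj u) = u := by
  obtain ⟨e, hxe, h1, -, h3⟩ := B.locally_trivial x
  have hsp : ∀ u, B.proj u ∈ U → B.proj (s (B.proj u)) = B.proj u := fun u hu => hs.proj_eq _ hu
  -- `γ u` compares the fibre coordinates of `u` and of the section point in the same fibre; it is
  -- smooth because the trivialization and `s` are.
  refine ⟨U ∩ e.baseSet, fun u => (e u).2 * (e (s (B.proj u))).2⁻¹, hs.isOpen.inter e.open_baseSet,
    ⟨hx, hxe⟩, inter_subset_left, ?_, ?_⟩
  · have h4 : ContMDiffOn 𝓘(ℝ, EP) 𝓘(ℝ, EG) ∞ (fun u => (e u).2) (B.proj ⁻¹' e.baseSet) :=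
      contMDiff_snd.comp_contMDiffOn h1
    refine (h4.mono fun u hu => hu.2).mul (ContMDiffOn.inv (I := 𝓘(ℝ, EG)) ?_)
    refine h4.comp (t := B.proj ⁻¹' e.baseSet) (hs.contMDiffOn.comp (t := U)
      B.contMDiff_proj.contMDiffOn fun u hu => hu.1) fun u hu => ?_
    change B.proj (s (B.proj u)) ∈ e.baseSet
    rw [hsp u hu.1]
    exact hu.2
  · rintro u ⟨hu, hue⟩
    obtain ⟨g, hg⟩ := B.exists_smul_eq (hsp u hu).symm
    have hse : B.proj (s (B.proj u)) ∈ e.baseSet := by rwa [hsp u hu]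
    have h4 := h3 _ hse g
    rw [hg] at h4
    change ((e u).2 * (e (s (B.proj u))).2⁻¹) • s (B.proj u) = u
    rw [show (e u).2 * (e (s (B.proj u))).2⁻¹ = g from mul_inv_eq_iff_eq_mul.2 h4, hg]

/-- The horizontal space at a point of a horizontal section is its tangent space. -/
theorem form_eq_zero_iff [LieGroup 𝓘(ℝ, EG) ∞ G] (hs : Γ.IsHorizontalSection U s) (hx : x ∈ U)
    (w : TangentSpace 𝓘(ℝ, EP) (s x)) :
    Γ.form (s x) w = 0 ↔ ∃ v : TangentSpace 𝓘(ℝ, EM) x,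
      mfderiv 𝓘(ℝ, EM) 𝓘(ℝ, EP) s x v = w := by
  refine ⟨fun hw => ?_, ?_⟩
  · obtain ⟨V, γ, hV, hxV, hVU, hγ, h⟩ := hs.exists_difference hx
    have hps : B.proj (s x) = x := hs.proj_eq x hx
    have hxV' : B.proj (s x) ∈ V := hps.symm ▸ hxV
    have h1 : γ (s x) = 1 := by
      have := h (s x) hxV'
      rw [hps] at this
      exact B.eq_one_of_smul_eq this
    have hσ : MDifferentiableAt 𝓘(ℝ, EM) 𝓘(ℝ, EP) s (B.proj (s x)) :=
      hs.mdifferentiableAt (hVU hxV')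
    have hnhds : B.proj ⁻¹' V ∈ 𝓝 (s x) :=
      (hV.preimage B.contMDiff_proj.continuous).mem_nhds hxV'
    -- The product rule for `u = γ u • s (p u)` writes `w` as the fundamental vector of `dγ w` plus
    -- `ds (dp w)`. The form returns `dγ w` on the first term and kills the second, so a horizontal
    -- `w` has `dγ w = 0` and equals `ds (dp w)`.
    have h2 := B.mfderiv_smul_comp (f := fun u : P => u) (x := s x)
      ((hγ.contMDiffAt hnhds).mdifferentiableAt (by simp))
      (B.contMDiff_proj.mdifferentiableAt (by simp)) hσ
      (by filter_upwards [hnhds] with u hu using (h u hu).symm) h1 w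
    have h3 : (mfderiv 𝓘(ℝ, EP) 𝓘(ℝ, EP) (fun u : P => u) (s x) w : EP) = w :=
      congrArg (fun L : EP →L[ℝ] EP => L w) mfderiv_id
    rw [h3, hps] at h2
    have h4 := Γ.form_fundamental (s x) (mfderiv 𝓘(ℝ, EP) 𝓘(ℝ, EG) γ (s x) w)
    have h5 := hs.horizontal x hx (mfderiv 𝓘(ℝ, EP) 𝓘(ℝ, EM) B.proj (s x) w : EM)
    have h6 := (congrArg (Γ.form (s x)) h2).trans (map_add (Γ.form (s x)) _ _)
    have h7 : (mfderiv 𝓘(ℝ, EP) 𝓘(ℝ, EG) γ (s x) w : EG) = 0 := by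
      have h8 := congrArg₂ (fun a b : EG => a + b) h4 h5
      have h9 := (hw.symm.trans h6).trans h8
      exact (h9.trans (add_zero (M := EG) _)).symm
    refine ⟨(mfderiv 𝓘(ℝ, EP) 𝓘(ℝ, EM) B.proj (s x) w : EM), ?_⟩
    refine (h2.trans ?_).symm
    rw [h7]
    exact (congrArg (fun a : EP => a + _) (map_zero _)).trans (zero_add (M := EP) _)
  · rintro ⟨v, rfl⟩
    exact hs.horizontal x hx v

/-- A horizontal map which meets a horizontal section runs in it locally. -/
theorem eventually_eq_comp_proj [LieGroup 𝓘(ℝ, EG) ∞ G] [IsManifold 𝓘(ℝ, EX) ∞ X]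
    (hs : Γ.IsHorizontalSection U s) {f : X → P} {y : X}
    (hf : ∀ᶠ y' in 𝓝 y, MDifferentiableAt 𝓘(ℝ, EX) 𝓘(ℝ, EP) f y' ∧
      ∀ v, Γ.form (f y') (mfderiv 𝓘(ℝ, EX) 𝓘(ℝ, EP) f y' v) = 0)
    (hy : B.proj (f y) ∈ U) (hys : f y = s (B.proj (f y))) :
    ∀ᶠ y' in 𝓝 y, f y' = s (B.proj (f y')) := by
  obtain ⟨V, γ, hV, hyV, hVU, hγ, h⟩ := hs.exists_difference hy
  have hO : IsOpen (B.proj ⁻¹' V) := hV.preimage B.contMDiff_proj.continuous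
  have hfV : ∀ᶠ y' in 𝓝 y, B.proj (f y') ∈ V :=
    hf.self_of_nhds.1.continuousAt.eventually (hO.mem_nhds hyV)
  have h1 : γ (f y) = 1 := by
    have := h (f y) hyV
    rw [← hys] at this
    exact B.eq_one_of_smul_eq this
  -- It suffices that the group coordinate `γ ∘ f` is locally constant, since its value at `y` is
  -- `1`.
  have hconst : ∀ᶠ y' in 𝓝 y, (fun z => γ (f z)) y' = (fun z => γ (f z)) y := by
    refine eventually_eq_of_mfderiv_eq_zero (EX := EX) (EY := EG) ?_
    filter_upwards [hf.eventually_nhds, hfV.eventually_nhds] with z hz hzV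
    have hfz := hz.self_of_nhds.1
    have hγz : MDifferentiableAt 𝓘(ℝ, EX) 𝓘(ℝ, EG) (fun z => γ (f z)) z :=
      MDifferentiableAt.comp z ((hγ.contMDiffAt (hO.mem_nhds hzV.self_of_nhds)).mdifferentiableAt
        (by simp)) hfz
    refine ⟨hγz, fun v => ?_⟩
    set g := γ (f z)
    -- The product rule needs a group factor equal to `1` at `z`. Right translation by `g⁻¹`
    -- achieves this, and the section `g • s`, again horizontal, absorbs the factor `g`.
    have hκ : MDifferentiableAt 𝓘(ℝ, EX) 𝓘(ℝ, EG) (fun z => γ (f z) * g⁻¹) z :=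
      MDifferentiableAt.comp (I' := 𝓘(ℝ, EG)) (g := fun h : G => h * g⁻¹) z
        ((contMDiff_mul_right (I := 𝓘(ℝ, EG)) (n := ∞)).mdifferentiableAt (by simp)) hγz
    have hsg := hs.smul g
    have hzU := hVU hzV.self_of_nhds
    have h2 := B.mfderiv_smul_comp (f := f) (c := fun z => B.proj (f z))
      (σ := fun x => g • s x) hκ
      (MDifferentiableAt.comp z (B.contMDiff_proj.mdifferentiableAt (by simp)) hfz)
      (hsg.mdifferentiableAt hzU)
      (by
        filter_upwards [hzV] with z' hz'
        rw [← mul_smul, inv_mul_cancel_right, h _ hz'])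
      (mul_inv_cancel g) v
    have h3 : g • s (B.proj (f z)) = f z := h _ hzV.self_of_nhds
    have h4 := Γ.form_fundamental (g • s (B.proj (f z)))
      (mfderiv 𝓘(ℝ, EX) 𝓘(ℝ, EG) (fun z => γ (f z) * g⁻¹) z v : EG)
    have h5 := hsg.horizontal _ hzU (mfderiv 𝓘(ℝ, EX) 𝓘(ℝ, EM) (fun z => B.proj (f z)) z v : EM)
    have h6 := (congrArg (Γ.form (g • s (B.proj (f z)))) h2).trans
      ((map_add (Γ.form (g • s (B.proj (f z)))) _ _).trans
        (congrArg₂ (fun a b : EG => a + b) h4 h5))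
    have h7 : Γ.form (g • s (B.proj (f z))) (mfderiv 𝓘(ℝ, EX) 𝓘(ℝ, EP) f z v : EP) = 0 := by
      rw [h3]; exact hz.self_of_nhds.2 v
    have h8 : (mfderiv 𝓘(ℝ, EX) 𝓘(ℝ, EG) (fun z => γ (f z) * g⁻¹) z v : EG) = 0 :=
      (add_zero (M := EG) _).symm.trans (h6.symm.trans h7)
    -- Right translation by `g` recovers `γ ∘ f`, so its derivative vanishes as well.
    have h9 := mfderiv_comp z (g := fun h : G => h * g) (I' := 𝓘(ℝ, EG)) (I'' := 𝓘(ℝ, EG))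
      ((contMDiff_mul_right (I := 𝓘(ℝ, EG)) (n := ∞)).mdifferentiableAt (by simp)) hκ
    have h10 : (fun h : G => h * g) ∘ (fun z => γ (f z) * g⁻¹) = fun z => γ (f z) := by
      ext z'; simp
    have h11 := congrArg (fun k : X → G => (mfderiv 𝓘(ℝ, EX) 𝓘(ℝ, EG) k z v : EG)) h10
    refine h11.symm.trans ((congrArg (fun L : EX →L[ℝ] EG => L v) h9).trans ?_)
    exact (congrArg (mfderiv 𝓘(ℝ, EG) 𝓘(ℝ, EG) (fun h : G => h * g) (γ (f z) * g⁻¹)) h8).trans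
      (map_zero _)
  filter_upwards [hconst, hfV] with y' hy' hV'
  have := h _ hV'
  rw [show γ (f y') = γ (f y) from hy', h1, one_smul] at this
  exact this.symm

/-- Two horizontal sections which agree at a point agree near it. -/
theorem eventually_eq [LieGroup 𝓘(ℝ, EG) ∞ G] [IsManifold 𝓘(ℝ, EM) ∞ M]
    (hs : Γ.IsHorizontalSection U s) (hs' : Γ.IsHorizontalSection V s') (hx : x ∈ U) (hx' : x ∈ V)
    (h : s x = s' x) : ∀ᶠ y in 𝓝 x, s y = s' y := by
  have hV := hs'.isOpen.mem_nhds hx'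
  have h1 := hs'.proj_eq x hx'
  have := hs.eventually_eq_comp_proj (f := s') (y := x)
    (by filter_upwards [hV] with y hy using ⟨hs'.mdifferentiableAt hy, hs'.horizontal y hy⟩)
    (h1.symm ▸ hx) (by rw [h1, h])
  filter_upwards [this, hV] with y hy hyV
  rw [hy, hs'.proj_eq y hyV]

end IsHorizontalSection

/-! ### The leaf topology and its covering of the base -/

/-- A horizontal section of a flat connection through a given point of the total space. -/
theorem IsFlat.exists_section (hΓ : Γ.IsFlat) (u : P) : ∃ (U : Set M) (s : M → P),
    B.proj u ∈ U ∧ Γ.IsHorizontalSection U s ∧ s (B.proj u) = u := by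
  obtain ⟨U, s, hU, hs⟩ := hΓ (B.proj u)
  obtain ⟨g, hg⟩ := B.exists_smul_eq (hs.proj_eq _ hU).symm
  exact ⟨U, fun x => g • s x, hU, hs.smul g, hg⟩

/-- The total space `P` with the leaf topology of a connection: the finest topology for which all
horizontal sections are continuous. -/
structure LeafSpace (Γ : B.Connection) where
  /-- the underlying point of the total space -/
  point : P

namespace LeafSpace

instance : TopologicalSpace Γ.LeafSpace where
  IsOpen W := ∀ (U : Set M) (s : M → P), Γ.IsHorizontalSection U s →
    IsOpen (U ∩ (fun x => (⟨s x⟩ : Γ.LeafSpace)) ⁻¹' W)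
  isOpen_univ U s hs := by simpa using hs.isOpen
  isOpen_inter W W' h h' U s hs := by
    rw [preimage_inter, inter_inter_distrib_left]
    exact (h U s hs).inter (h' U s hs)
  isOpen_sUnion S h U s hs := by
    rw [preimage_sUnion, inter_iUnion₂]
    exact isOpen_biUnion fun W hW => h W hW U s hs

theorem isOpen_def {W : Set Γ.LeafSpace} : IsOpen W ↔ ∀ (U : Set M) (s : M → P),
    Γ.IsHorizontalSection U s → IsOpen (U ∩ (fun x => (⟨s x⟩ : Γ.LeafSpace)) ⁻¹' W) := Iff.rfl

theorem continuousOn_section (hs : Γ.IsHorizontalSection U s) :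
    ContinuousOn (fun x => (⟨s x⟩ : Γ.LeafSpace)) U :=
  (continuousOn_open_iff hs.isOpen).2 fun _ hW => hW U s hs

theorem continuous_point : Continuous (point : Γ.LeafSpace → P) :=
  continuous_def.2 fun _ hO _ _ hs => hs.contMDiffOn.continuousOn.isOpen_inter_preimage hs.isOpen hO

/-- The projection of the leaf space to the base. -/
def proj (l : Γ.LeafSpace) : M := B.proj l.point

theorem continuous_proj : Continuous (proj : Γ.LeafSpace → M) :=
  B.contMDiff_proj.continuous.comp continuous_point

/-- Local uniqueness enters here: a horizontal section that meets the sheet of `s` at a point stays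
in it near that point. -/
theorem isOpen_sheet [LieGroup 𝓘(ℝ, EG) ∞ G] [IsManifold 𝓘(ℝ, EM) ∞ M]
    (hs : Γ.IsHorizontalSection U s) :
    IsOpen {l : Γ.LeafSpace | l.proj ∈ U ∧ s l.proj = l.point} := by
  refine isOpen_def.2 fun V s' hs' => isOpen_iff_mem_nhds.2 ?_
  rintro x ⟨hxV, hxU, hx⟩
  have hp : B.proj (s' x) = x := hs'.proj_eq x hxV
  simp only [proj, hp] at hxU hx
  filter_upwards [hs.eventually_eq hs' hxU hxV hx, hs.isOpen.mem_nhds hxU,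
    hs'.isOpen.mem_nhds hxV] with y hy hyU hyV
  have hpy : B.proj (s' y) = y := hs'.proj_eq y hyV
  exact ⟨hyV, by simpa [proj, hpy] using hyU, by simpa [proj, hpy] using hy⟩

theorem eventually_mem_sheet [LieGroup 𝓘(ℝ, EG) ∞ G] [IsManifold 𝓘(ℝ, EM) ∞ M]
    (hs : Γ.IsHorizontalSection U s) {l : Γ.LeafSpace} (hl : l.proj ∈ U) (h : s l.proj = l.point) :
    ∀ᶠ l' : Γ.LeafSpace in 𝓝 l, l'.proj ∈ U ∧ s l'.proj = l'.point :=
  (isOpen_sheet hs).mem_nhds ⟨hl, h⟩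

/-- On the open sheet of a section the projection is inverted by that section, and flatness puts a
sheet through every point. -/
theorem isLocalHomeomorph_proj [LieGroup 𝓘(ℝ, EG) ∞ G] [IsManifold 𝓘(ℝ, EM) ∞ M]
    (hΓ : Γ.IsFlat) : IsLocalHomeomorph (proj : Γ.LeafSpace → M) := by
  refine IsLocalHomeomorph.mk _ fun l => ?_
  obtain ⟨U, s, hU, hs, hsl⟩ := hΓ.exists_section l.point
  refine ⟨{ toFun := proj
            invFun := fun x => ⟨s x⟩
            source := {l | l.proj ∈ U ∧ s l.proj = l.point}
            target := U
            map_source' := fun l hl => hl.1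
            map_target' := fun x hx => ?_
            left_inv' := fun l hl => congrArg LeafSpace.mk hl.2
            right_inv' := fun x hx => hs.proj_eq x hx
            open_source := isOpen_sheet hs
            open_target := hs.isOpen
            continuousOn_toFun := continuous_proj.continuousOn
            continuousOn_invFun := continuousOn_section hs }, ⟨hU, hsl⟩, fun _ _ => rfl⟩
  have hp : B.proj (s x) = x := hs.proj_eq x hx
  exact ⟨by simpa [proj, hp] using hx, by simp [proj, hp]⟩

instance : MulAction G Γ.LeafSpace where
  smul g l := ⟨g • l.point⟩
  one_smul l := congrArg LeafSpace.mk (one_smul G l.point)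
  mul_smul g h l := congrArg LeafSpace.mk (mul_smul g h l.point)

/-- Translation permutes the horizontal sections that define the topology. -/
instance : ContinuousConstSMul G Γ.LeafSpace where
  continuous_const_smul g := continuous_def.2 fun _ hW U _ hs => hW U _ (hs.smul g)

/-- The leaf space of a flat connection is a covering space of the base, with group `G`. -/
theorem isQuotientCoveringMap_proj [LieGroup 𝓘(ℝ, EG) ∞ G] [IsManifold 𝓘(ℝ, EM) ∞ M]
    (hΓ : Γ.IsFlat) : IsQuotientCoveringMap (proj : Γ.LeafSpace → M) G where
  toIsQuotientMap := (isLocalHomeomorph_proj hΓ).isOpenMap.isQuotientMap continuous_proj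
    fun x => (B.exists_proj_eq x).imp' LeafSpace.mk fun _ h => h
  continuous_const_smul := continuous_const_smul
  apply_eq_iff_mem_orbit {l l'} := by
    refine ⟨fun h => ?_, ?_⟩
    · obtain ⟨g, hg⟩ := B.exists_smul_eq (u := l.point) (v := l'.point) h
      exact ⟨g, congrArg LeafSpace.mk hg⟩
    · rintro ⟨g, rfl⟩
      exact B.proj_smul g l'.point
  -- The sheet of `s` meets each fibre at most once. If it contains `l'` and `g • l'`, which have
  -- the same projection, then they coincide and freeness gives `g = 1`.
  disjoint l := by
    obtain ⟨U, s, hU, hs, hsl⟩ := hΓ.exists_section l.point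
    refine ⟨_, (isOpen_sheet hs).mem_nhds ⟨hU, hsl⟩, fun g => ?_⟩
    rintro ⟨_, ⟨l', ⟨-, h⟩, rfl⟩, -, h'⟩
    have h2 : s (B.proj (g • l'.point)) = g • l'.point := h'
    rw [B.proj_smul] at h2
    refine B.eq_one_of_smul_eq (u := l'.point) ?_
    rw [← h2]
    exact h

theorem isCoveringMap_proj [LieGroup 𝓘(ℝ, EG) ∞ G] [IsManifold 𝓘(ℝ, EM) ∞ M] (hΓ : Γ.IsFlat) :
    IsCoveringMap (proj : Γ.LeafSpace → M) :=
  (isQuotientCoveringMap_proj hΓ).isCoveringMap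

/-- A map which runs locally in horizontal sections is continuous for the leaf topology. -/
theorem continuousAt_of_eventually {Z : Type*} [TopologicalSpace Z] {f : Z → P} {z : Z}
    (hf : ContinuousAt (fun z => B.proj (f z)) z) (hs : Γ.IsHorizontalSection U s)
    (hU : B.proj (f z) ∈ U) (h : ∀ᶠ z' in 𝓝 z, f z' = s (B.proj (f z'))) :
    ContinuousAt (fun z => (⟨f z⟩ : Γ.LeafSpace)) z := by
  have h1 : ContinuousAt (fun x => (⟨s x⟩ : Γ.LeafSpace)) (B.proj (f z)) :=
    (continuousOn_section hs).continuousAt (hs.isOpen.mem_nhds hU)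
  refine (ContinuousAt.comp (f := fun z => B.proj (f z)) h1 hf).congr ?_
  filter_upwards [h] with z' hz'
  exact congrArg LeafSpace.mk hz'.symm

end LeafSpace

/-! ### Horizontal paths and the leaf through a point -/

/-- A horizontal path is a path in the leaf space. -/
def IsHorizontalPath.lift {a b : P} {z : Path a b} (hz : Γ.IsHorizontalPath z) :
    Path (⟨a⟩ : Γ.LeafSpace) ⟨b⟩ where
  toFun t := ⟨z t⟩
  continuous_toFun := continuous_iff_continuousAt.2 fun t => by
    obtain ⟨U, s, hs, h⟩ := hz t
    exact LeafSpace.continuousAt_of_eventually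
      (B.contMDiff_proj.continuous.comp z.continuous).continuousAt hs h.self_of_nhds.1
      (h.mono fun _ h => h.2)
  source' := congrArg LeafSpace.mk z.source
  target' := congrArg LeafSpace.mk z.target

/-- Converse to `IsHorizontalPath.lift`: near each time a leaf path remains in the open sheet
through its current point. -/
theorem IsFlat.isHorizontalPath_map [LieGroup 𝓘(ℝ, EG) ∞ G] [IsManifold 𝓘(ℝ, EM) ∞ M]
    (hΓ : Γ.IsFlat) {a b : Γ.LeafSpace} (z : Path a b) :
    Γ.IsHorizontalPath (z.map LeafSpace.continuous_point) := fun t => by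
  obtain ⟨U, s, hU, hs, hst⟩ := hΓ.exists_section (z t).point
  refine ⟨U, s, hs, ?_⟩
  filter_upwards [z.continuous.continuousAt.eventually
    (LeafSpace.eventually_mem_sheet hs hU hst)] with t' ht'
  exact ⟨ht'.1, ht'.2.symm⟩

theorem IsFlat.mem_holonomyBundle_iff [LieGroup 𝓘(ℝ, EG) ∞ G] [IsManifold 𝓘(ℝ, EM) ∞ M]
    (hΓ : Γ.IsFlat) {x₀ u : P} :
    u ∈ Γ.holonomyBundle x₀ ↔ Joined (⟨x₀⟩ : Γ.LeafSpace) ⟨u⟩ :=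
  ⟨fun ⟨_, hz⟩ => ⟨hz.lift⟩, fun ⟨z⟩ => ⟨_, hΓ.isHorizontalPath_map z⟩⟩

/-- The leaf of a connection through a point, with the leaf topology. -/
abbrev Leaf (Γ : B.Connection) (x₀ : P) : Type u := pathComponent (⟨x₀⟩ : Γ.LeafSpace)

/-- The inclusion of a leaf. -/
def Leaf.incl {x₀ : P} (y : Γ.Leaf x₀) : P := y.1.point

/-- The projection of a leaf to the base. -/
def Leaf.proj {x₀ : P} (y : Γ.Leaf x₀) : M := B.proj y.incl

namespace IsFlat

/-- An integral manifold is continuous for the leaf topology. -/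
theorem continuous_leafSpace [LieGroup 𝓘(ℝ, EG) ∞ G] (hΓ : Γ.IsFlat) {L : Type u}
    [TopologicalSpace L] [ChartedSpace EM L] [IsManifold 𝓘(ℝ, EM) ∞ L] {j : L → P} (hj : Γ.IsIntegralManifold j) :
    Continuous fun y => (⟨j y⟩ : Γ.LeafSpace) := by
  refine continuous_iff_continuousAt.2 fun y => ?_
  obtain ⟨U, s, hU, hs, hsy⟩ := hΓ.exists_section (j y)
  refine LeafSpace.continuousAt_of_eventually
    (B.contMDiff_proj.continuous.comp hj.contMDiff.continuous).continuousAt hs hU ?_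
  refine hs.eventually_eq_comp_proj (EX := EM) (Filter.Eventually.of_forall fun y' =>
    ⟨hj.contMDiff.mdifferentiableAt (by simp), fun v => (hj.mfderiv_range y' _).1 ⟨v, rfl⟩⟩)
    hU hsy.symm

variable [LieGroup 𝓘(ℝ, EG) ∞ G] [IsManifold 𝓘(ℝ, EM) ∞ M] {x₀ : P}

/-- The projection gives the leaf space charts in the normed space `EM`. This makes path components
open and equal to connected components. -/
theorem locallyPathConnectedSpace (hΓ : Γ.IsFlat) : LocallyPathConnectedSpace Γ.LeafSpace :=
  let := pullbackChartedSpace (E := EM) (LeafSpace.isLocalHomeomorph_proj hΓ)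
  ChartedSpace.locallyPathConnectedSpace EM Γ.LeafSpace

theorem isLocalHomeomorph_leafProj (hΓ : Γ.IsFlat) :
    IsLocalHomeomorph (Leaf.proj : Γ.Leaf x₀ → M) :=
  have := hΓ.locallyPathConnectedSpace
  (LeafSpace.isLocalHomeomorph_proj hΓ).comp
    (IsOpen.pathComponent (⟨x₀⟩ : Γ.LeafSpace)).isOpenEmbedding_subtypeVal.isLocalHomeomorph

theorem range_incl (hΓ : Γ.IsFlat) : range (Leaf.incl : Γ.Leaf x₀ → P) = Γ.holonomyBundle x₀ := by
  ext u
  rw [hΓ.mem_holonomyBundle_iff]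
  exact ⟨fun ⟨y, hy⟩ => hy ▸ y.2, fun h => ⟨⟨⟨u⟩, h⟩, rfl⟩⟩

/-- The smooth structure of a leaf of a flat connection, for which the projection to the base is a
local diffeomorphism. -/
@[reducible] def leafChartedSpace (hΓ : Γ.IsFlat) (x₀ : P) : ChartedSpace EM (Γ.Leaf x₀) :=
  pullbackChartedSpace hΓ.isLocalHomeomorph_leafProj

theorem isLocalDiffeomorph_leafProj (hΓ : Γ.IsFlat) :
    letI := hΓ.leafChartedSpace x₀
    IsLocalDiffeomorph 𝓘(ℝ, EM) 𝓘(ℝ, EM) ∞ (Leaf.proj : Γ.Leaf x₀ → M) :=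
  pullback_isLocalDiffeomorph hΓ.isLocalHomeomorph_leafProj

/-- Locally the inclusion is a horizontal section after the projection, which is a local
diffeomorphism. Its derivative thus has the range of the derivative of the section, namely the
horizontal space. -/
theorem isIntegralManifold_incl (hΓ : Γ.IsFlat) :
    letI := hΓ.leafChartedSpace x₀
    Γ.IsIntegralManifold (Leaf.incl : Γ.Leaf x₀ → P) := by
  let := hΓ.leafChartedSpace x₀
  have hloc : ∀ y : Γ.Leaf x₀, ∃ (U : Set M) (s : M → P), y.proj ∈ U ∧
      Γ.IsHorizontalSection U s ∧ s y.proj = y.incl ∧ Leaf.incl =ᶠ[𝓝 y] s ∘ Leaf.proj := by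
    intro y
    obtain ⟨U, s, hU, hs, hsy⟩ := hΓ.exists_section y.incl
    refine ⟨U, s, hU, hs, hsy, ?_⟩
    filter_upwards [continuous_subtype_val.continuousAt.eventually
      (LeafSpace.eventually_mem_sheet hs hU hsy)] with y' hy'
    exact hy'.2.symm
  have hproj := hΓ.isLocalDiffeomorph_leafProj (x₀ := x₀)
  have hderiv : ∀ (y : Γ.Leaf x₀) (s : M → P), MDifferentiableAt 𝓘(ℝ, EM) 𝓘(ℝ, EP) s y.proj →
      Leaf.incl =ᶠ[𝓝 y] s ∘ Leaf.proj → ∀ v : EM,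
      (mfderiv 𝓘(ℝ, EM) 𝓘(ℝ, EP) (Leaf.incl : Γ.Leaf x₀ → P) y v : EP) =
        mfderiv 𝓘(ℝ, EM) 𝓘(ℝ, EP) s y.proj
          (mfderiv 𝓘(ℝ, EM) 𝓘(ℝ, EM) (Leaf.proj : Γ.Leaf x₀ → M) y v) := by
    intro y s hs h v
    have h1 := h.mfderiv_eq (I := 𝓘(ℝ, EM)) (I' := 𝓘(ℝ, EP))
    have h2 := mfderiv_comp y hs (hproj.mdifferentiable (by simp) y)
    exact congrArg (fun L : EM →L[ℝ] EP => L v) (h1.trans h2)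
  refine ⟨fun y => ?_, ?_, fun y => ?_, fun y w => ?_⟩
  · obtain ⟨U, s, hU, hs, -, h⟩ := hloc y
    exact ((hs.contMDiffAt hU).comp y (hproj.contMDiff y)).congr_of_eventuallyEq h
  · rintro ⟨⟨a⟩, ha⟩ ⟨⟨b⟩, hb⟩ (rfl : a = b)
    rfl
  · obtain ⟨U, s, hU, hs, -, h⟩ := hloc y
    have hd := hderiv y s (hs.mdifferentiableAt hU) h
    let D := hproj.mfderivToContinuousLinearEquiv (by simp) y
    -- The section has the left inverse `p`, so its derivative is injective.
    have h1 : B.proj ∘ s =ᶠ[𝓝 y.proj] id := by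
      filter_upwards [hs.isOpen.mem_nhds hU] with x hx using hs.proj_eq x hx
    have h2 := (mfderiv_comp y.proj (B.contMDiff_proj.mdifferentiableAt (by simp))
      (hs.mdifferentiableAt hU)).symm.trans (h1.mfderiv_eq.trans mfderiv_id)
    intro v v' hv
    have h3 : (mfderiv 𝓘(ℝ, EM) 𝓘(ℝ, EP) s y.proj (D v) : EP) =
      mfderiv 𝓘(ℝ, EM) 𝓘(ℝ, EP) s y.proj (D v') := (hd v).symm.trans (hv.trans (hd v'))
    have h4 : ∀ a : EM, (mfderiv 𝓘(ℝ, EP) 𝓘(ℝ, EM) B.proj (s y.proj)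
        (mfderiv 𝓘(ℝ, EM) 𝓘(ℝ, EP) s y.proj a) : EM) = a := fun a =>
      congrArg (fun L : EM →L[ℝ] EM => L a) h2
    have h5 : D v = D v' := (h4 (D v)).symm.trans ((congrArg (fun a : EP =>
      (mfderiv 𝓘(ℝ, EP) 𝓘(ℝ, EM) B.proj (s y.proj) a : EM)) h3).trans (h4 (D v')))
    exact D.injective h5
  · obtain ⟨U, s, hU, hs, hsy, h⟩ := hloc y
    have hd := hderiv y s (hs.mdifferentiableAt hU) h
    let D := hproj.mfderivToContinuousLinearEquiv (by simp) y
    have h1 := hs.form_eq_zero_iff hU w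
    rw [hsy] at h1
    rw [h1]
    constructor
    · rintro ⟨v, hv⟩
      exact ⟨D v, (hd v).symm.trans hv⟩
    · rintro ⟨v, hv⟩
      refine ⟨D.symm v, (hd _).trans (Eq.trans ?_ hv)⟩
      exact congrArg (fun a : EM => (mfderiv 𝓘(ℝ, EM) 𝓘(ℝ, EP) s y.proj a : EP))
        (D.apply_symm_apply v)

/-- A connected integral manifold through `x₀` is continuous for the leaf topology, so it lies in
the connected component of `x₀`, which is the path component. -/
theorem isMaximalLeaf_incl (hΓ : Γ.IsFlat) :
    letI := hΓ.leafChartedSpace x₀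
    Γ.IsMaximalLeaf x₀ (Leaf.incl : Γ.Leaf x₀ → P) := by
  let := hΓ.leafChartedSpace x₀
  refine ⟨pullback_isManifold hΓ.isLocalHomeomorph_leafProj, ?_, hΓ.isIntegralManifold_incl, ?_, ?_⟩
  · exact isConnected_iff_connectedSpace.1 (isPathConnected_pathComponent).isConnected
  · exact ⟨⟨⟨x₀⟩, mem_pathComponent_self _⟩, rfl⟩
  · rintro L _ _ _ _ j hj ⟨y₀, hy₀⟩
    have := hΓ.locallyPathConnectedSpace
    have hc := hΓ.continuous_leafSpace hj
    have hmem : ∀ y, (⟨j y⟩ : Γ.LeafSpace) ∈ pathComponent (⟨x₀⟩ : Γ.LeafSpace) := by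
      intro y
      rw [pathComponent_eq_connectedComponent]
      refine (isPreconnected_range hc).subset_connectedComponent
        ⟨y₀, congrArg LeafSpace.mk hy₀⟩ ⟨y, rfl⟩
    refine ⟨fun y => ⟨⟨j y⟩, hmem y⟩, fun y => ?_, fun _ => rfl⟩
    -- Smoothness into the leaf is tested after projecting to `M`, where the map becomes `p ∘ j`.
    exact contMDiffWithinAt_of_comp hΓ.isLocalDiffeomorph_leafProj
      (hc.subtype_mk hmem).continuousWithinAt
      ((B.contMDiff_proj.comp hj.contMDiff).contMDiffAt) (mem_univ y)

end IsFlat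

/-! ### Uniqueness of maximal leaves -/

namespace IsMaximalLeaf

variable {x₀ : P} {N : Type u} [TopologicalSpace N] [ChartedSpace EM N] {i : N → P}

/-- Maximal leaves through the same point are diffeomorphic. -/
theorem exists_diffeomorph {N' : Type u} [TopologicalSpace N'] [ChartedSpace EM N'] {i' : N' → P}
    (h : Γ.IsMaximalLeaf x₀ i) (h' : Γ.IsMaximalLeaf x₀ i') :
    ∃ Φ : N ≃ₘ⟮𝓘(ℝ, EM), 𝓘(ℝ, EM)⟯ N', ∀ y, i' (Φ y) = i y := by
  have := h.isManifold
  have := h'.isManifold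
  have := h.connected
  have := h'.connected
  obtain ⟨a, ha, hia⟩ := h'.maximal N i h.integral h.mem_range
  obtain ⟨b, hb, hib⟩ := h.maximal N' i' h'.integral h'.mem_range
  exact ⟨⟨⟨a, b, fun y => h.integral.injective (by rw [hib, hia]),
    fun y => h'.integral.injective (by rw [hia, hib])⟩, ha, hb⟩, hia⟩

variable [LieGroup 𝓘(ℝ, EG) ∞ G] [IsManifold 𝓘(ℝ, EM) ∞ M]

/-- Uniqueness reduces the claim to the path component model `Leaf`. -/
theorem range_eq (h : Γ.IsMaximalLeaf x₀ i) (hΓ : Γ.IsFlat) : range i = Γ.holonomyBundle x₀ := by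
  let := hΓ.leafChartedSpace x₀
  obtain ⟨Φ, hΦ⟩ := h.exists_diffeomorph hΓ.isMaximalLeaf_incl
  rw [← hΓ.range_incl, ← funext hΦ]
  exact Φ.surjective.range_comp Leaf.incl

theorem isLocalDiffeomorph_proj (h : Γ.IsMaximalLeaf x₀ i) (hΓ : Γ.IsFlat) :
    IsLocalDiffeomorph 𝓘(ℝ, EM) 𝓘(ℝ, EM) ∞ fun y => B.proj (i y) := by
  let := hΓ.leafChartedSpace x₀
  obtain ⟨Φ, hΦ⟩ := h.exists_diffeomorph hΓ.isMaximalLeaf_incl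
  have heq : (fun y => B.proj (i y)) = Leaf.proj ∘ Φ := funext fun y => congrArg B.proj (hΦ y).symm
  rw [heq]
  exact fun y => (Φ.isLocalDiffeomorph y).comp _ _ (hΓ.isLocalDiffeomorph_leafProj _)

end IsMaximalLeaf

/-! ### The induced connection and its leaf topology -/

variable {M' : Type u} [TopologicalSpace M'] [ChartedSpace EM M'] {q : SmoothCovering EM M M'}
  [LieGroup 𝓘(ℝ, EG) ∞ G]

/-- A horizontal section of a connection induces one of the induced connection. -/
theorem IsHorizontalSection.exists_induced (hs : Γ.IsHorizontalSection U s) :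
    ∃ s' : M' → B.InducedSpace q, (Γ.induced q).IsHorizontalSection (q.toFun ⁻¹' U) s' ∧
      ∀ m, q.toFun m ∈ U → B.inducedMap (s' m) = s (q.toFun m) := by
  -- Over `U` the lift is `(m, s (q m))`; elsewhere any point of the fibre serves, only to make the
  -- function total.
  have hex : ∀ m : M', ∃ z : B.InducedSpace q, B.inducedProj z = m ∧
      (q.toFun m ∈ U → B.inducedMap z = s (q.toFun m)) := by
    intro m
    by_cases hm : q.toFun m ∈ U
    · exact ⟨⟨m, s (q.toFun m), (hs.proj_eq _ hm).symm⟩, rfl, fun _ => rfl⟩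
    · obtain ⟨u, hu⟩ := B.exists_proj_eq (q.toFun m)
      exact ⟨⟨m, u, hu.symm⟩, rfl, fun h => absurd h hm⟩
  choose s' hproj hmap using hex
  have hU : IsOpen (q.toFun ⁻¹' U) := hs.isOpen.preimage q.isCoveringMap.continuous
  have hcomp : ContMDiffOn 𝓘(ℝ, EM) 𝓘(ℝ, EP) ∞ (fun m => B.inducedMap (s' m))
      (q.toFun ⁻¹' U) :=
    (hs.contMDiffOn.comp q.isLocalDiffeomorph.contMDiff.contMDiffOn fun m hm => hm).congr hmap
  have hcont : ContinuousOn s' (q.toFun ⁻¹' U) :=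
    B.continuousOn_induced_iff.2 ⟨continuousOn_id.congr fun m _ => hproj m, hcomp.continuousOn⟩
  have hsmooth : ContMDiffOn 𝓘(ℝ, EM) 𝓘(ℝ, EP) ∞ s' (q.toFun ⁻¹' U) := fun m hm =>
    contMDiffWithinAt_of_comp B.isLocalDiffeomorph_inducedMap (hcont m hm) (hcomp m hm) hm
  refine ⟨s', ⟨hU, hsmooth, fun m _ => hproj m, fun m hm v => ?_⟩, hmap⟩
  have h1 := mfderiv_comp m
    (B.isLocalDiffeomorph_inducedMap.mdifferentiable (n := ∞) (by simp) (s' m))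
    ((hsmooth.contMDiffAt (hU.mem_nhds hm)).mdifferentiableAt (by simp))
  have h2 := mfderiv_comp m (hs.mdifferentiableAt hm)
    (q.isLocalDiffeomorph.mdifferentiable (by simp) m)
  -- The induced form on `ds' v` is the original form on the derivative of this common composite,
  -- and `s` is horizontal.
  have h3 : B.inducedMap ∘ s' =ᶠ[𝓝 m] s ∘ q.toFun := by
    filter_upwards [hU.mem_nhds hm] with m' hm' using hmap m' hm'
  have h4 := congrArg (fun L : EM →L[ℝ] EP => L v)
    (h1.symm.trans ((h3.mfderiv_eq (I := 𝓘(ℝ, EM)) (I' := 𝓘(ℝ, EP))).trans h2))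
  have h5 : ∀ u : P, u = s (q.toFun m) → Γ.form u (mfderiv 𝓘(ℝ, EM) 𝓘(ℝ, EP) s (q.toFun m)
      (mfderiv 𝓘(ℝ, EM) 𝓘(ℝ, EM) q.toFun m v) : EP) = 0 := by
    rintro _ rfl
    exact hs.horizontal _ hm _
  exact (congrArg (Γ.form (B.inducedMap (s' m))) h4).trans (h5 _ (hmap m hm))

theorem IsFlat.induced (hΓ : Γ.IsFlat) : (Γ.induced q).IsFlat := fun m => by
  obtain ⟨U, s, hU, hs⟩ := hΓ (q.toFun m)
  obtain ⟨s', hs', -⟩ := hs.exists_induced (q := q)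
  exact ⟨_, s', hU, hs'⟩

/-- The bundle map of an induced bundle is continuous for the leaf topologies. -/
theorem IsFlat.continuous_leafSpace_inducedMap [IsManifold 𝓘(ℝ, EM) ∞ M'] (hΓ : Γ.IsFlat) :
    Continuous fun l : (Γ.induced q).LeafSpace => (⟨B.inducedMap l.point⟩ : Γ.LeafSpace) := by
  refine continuous_iff_continuousAt.2 fun l => ?_
  obtain ⟨U, s, hU, hs, hsl⟩ := hΓ.exists_section (B.inducedMap l.point)
  obtain ⟨s', hs', hmap⟩ := hs.exists_induced (q := q)
  have hpm : ∀ z : B.InducedSpace q, q.toFun ((B.induced q).proj z) = B.proj (B.inducedMap z) :=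
    B.proj_inducedMap
  have hlU : l.proj ∈ q.toFun ⁻¹' U := by
    rw [mem_preimage, LeafSpace.proj, hpm]
    exact hU
  refine LeafSpace.continuousAt_of_eventually (f := fun l : (Γ.induced q).LeafSpace =>
    B.inducedMap l.point) ?_ hs hU ?_
  · exact (B.contMDiff_proj.continuous.comp
      (B.continuous_inducedMap.comp LeafSpace.continuous_point)).continuousAt
  · have hl : s' l.proj = l.point := by
      refine B.induced_ext (hs'.proj_eq _ hlU) ?_
      rw [hmap _ hlU, LeafSpace.proj, hpm, hsl]
    filter_upwards [LeafSpace.eventually_mem_sheet hs' hlU hl] with l' hl'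
    conv_lhs => rw [← hl'.2, hmap _ hl'.1, LeafSpace.proj, hpm]

/-- A path in the leaf space together with a lift of its projection to `M'` is a path in the leaf
space of the induced connection. -/
theorem IsFlat.continuous_leafSpace_induced [IsManifold 𝓘(ℝ, EM) ∞ M] (hΓ : Γ.IsFlat)
    {Z : Type*} [TopologicalSpace Z] {f : Z → B.InducedSpace q}
    (h₁ : Continuous fun z => B.inducedProj (f z))
    (h₂ : Continuous fun z => (⟨B.inducedMap (f z)⟩ : Γ.LeafSpace)) :
    Continuous fun z => (⟨f z⟩ : (Γ.induced q).LeafSpace) := by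
  refine continuous_iff_continuousAt.2 fun z => ?_
  obtain ⟨U, s, hU, hs, hsl⟩ := hΓ.exists_section (B.inducedMap (f z))
  obtain ⟨s', hs', hmap⟩ := hs.exists_induced (q := q)
  have hzU : q.toFun (B.inducedProj (f z)) ∈ U := by
    rw [B.proj_inducedMap]
    exact hU
  refine LeafSpace.continuousAt_of_eventually (f := f) h₁.continuousAt hs' hzU ?_
  filter_upwards [h₂.continuousAt.eventually (LeafSpace.eventually_mem_sheet hs hU hsl)] with z' hz'
  have hz'U : q.toFun (B.inducedProj (f z')) ∈ U := by
    rw [B.proj_inducedMap]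
    exact hz'.1
  refine B.induced_ext (hs'.proj_eq _ hz'U).symm ((Eq.trans ?_ (hmap _ hz'U).symm))
  rw [B.proj_inducedMap]
  exact hz'.2.symm

/-! ### Trivial holonomy and the bijection of holonomy bundles -/

/-- The holonomy of the projection of a loop in the leaf space is trivial. -/
theorem IsFlat.holonomy_eq_one [IsManifold 𝓘(ℝ, EM) ∞ M] (hΓ : Γ.IsFlat) {x₀ : P}
    (z : Path (⟨x₀⟩ : Γ.LeafSpace) ⟨x₀⟩) :
    Γ.holonomy x₀ (Path.Homotopic.Quotient.mk (z.map LeafSpace.continuous_proj)) = 1 := by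
  set c := Path.Homotopic.Quotient.mk (z.map LeafSpace.continuous_proj)
  -- The holonomy is a choice by `Classical.epsilon`, so its specification needs a witness first:
  -- `z` itself is a horizontal lift, with `g = 1`.
  have hex : ∃ g : G, ∃ w : Path x₀ (g • x₀), Γ.IsHorizontalPath w ∧
      Path.Homotopic.Quotient.mk
        ((w.map B.contMDiff_proj.continuous).cast rfl (B.proj_smul g x₀).symm) = c :=
    ⟨1, (z.map LeafSpace.continuous_point).cast rfl (one_smul G x₀), hΓ.isHorizontalPath_map z, rfl⟩
  have hspec : ∃ w : Path x₀ (Γ.holonomy x₀ c • x₀), Γ.IsHorizontalPath w ∧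
      Path.Homotopic.Quotient.mk
        ((w.map B.contMDiff_proj.continuous).cast rfl (B.proj_smul _ x₀).symm) = c :=
    Classical.epsilon_spec hex
  suffices h : Γ.holonomy x₀ c = 1 from h
  generalize Γ.holonomy x₀ c = g at hspec ⊢
  obtain ⟨w, hw, hwc⟩ := hspec
  have cov := LeafSpace.isCoveringMap_proj hΓ
  -- In the covering by the leaf space, `z` and the lift of `w` start at the same point over the
  -- same class `c`. Hence they end at the same point, so `g • x₀ = x₀`.
  have h1 := cov.monodromy_eq_of_map_eq (x := B.proj x₀) (y := B.proj x₀) (γ := c)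
    (ex := ⟨⟨x₀⟩, rfl⟩) (ey := ⟨⟨x₀⟩, rfl⟩) (Path.Homotopic.Quotient.mk z) rfl
  have h2 := cov.monodromy_eq_of_map_eq (x := B.proj x₀) (y := B.proj x₀) (γ := c)
    (ex := ⟨⟨x₀⟩, rfl⟩) (ey := ⟨⟨g • x₀⟩, B.proj_smul _ _⟩)
    (Path.Homotopic.Quotient.mk hw.lift) (by rw [← hwc]; rfl)
  have h3 := congrArg (fun l => l.1.point) (h2.symm.trans h1)
  exact B.eq_one_of_smul_eq h3

/-- If `π₁(M')` is the kernel of the holonomy morphism, then the bundle map of the induced bundle is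
a bijection between the holonomy bundles. -/
theorem IsFlat.bijOn_holonomyBundle [IsManifold 𝓘(ℝ, EM) ∞ M] [IsManifold 𝓘(ℝ, EM) ∞ M']
    (hΓ : Γ.IsFlat) {x₀ : P} {x₀' : B.InducedSpace q} (hx : B.inducedMap x₀' = x₀)
    (hker : (q.pi1 ((B.proj_inducedMap x₀').trans (congrArg B.proj hx)) :
      Set (FundamentalGroup M (B.proj x₀))) = {c | Γ.holonomy x₀ c = 1}) :
    BijOn B.inducedMap ((Γ.induced q).holonomyBundle x₀') (Γ.holonomyBundle x₀) := by
  subst hx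
  have hΓ' := hΓ.induced (q := q)
  have hdown := hΓ.continuous_leafSpace_inducedMap (q := q)
  refine ⟨fun u hu => ?_, fun u₁ hu₁ u₂ hu₂ hu => ?_, fun u hu => ?_⟩
  · rw [hΓ'.mem_holonomyBundle_iff] at hu
    rw [hΓ.mem_holonomyBundle_iff]
    exact hu.map hdown
  · obtain ⟨z₁⟩ := hΓ'.mem_holonomyBundle_iff.1 hu₁
    obtain ⟨z₂⟩ := hΓ'.mem_holonomyBundle_iff.1 hu₂
    refine B.induced_ext ?_ hu
    -- Downstairs the two paths have the same ends, so `w₁` followed by the reverse of `w₂` is a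
    -- loop in the leaf space and its projection `c` has trivial holonomy.
    let w₁ : Path (⟨B.inducedMap x₀'⟩ : Γ.LeafSpace) ⟨B.inducedMap u₁⟩ := z₁.map hdown
    let w₂ : Path (⟨B.inducedMap x₀'⟩ : Γ.LeafSpace) ⟨B.inducedMap u₁⟩ :=
      (z₂.map hdown).cast rfl (congrArg LeafSpace.mk hu)
    have hloop := hΓ.holonomy_eq_one (w₁.trans w₂.symm)
    set c : FundamentalGroup M (B.proj (B.inducedMap x₀')) :=
      Path.Homotopic.Quotient.mk ((w₁.trans w₂.symm).map LeafSpace.continuous_proj)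
    have hmem : c ∈ {c | Γ.holonomy (B.inducedMap x₀') c = 1} := hloop
    rw [← hker] at hmem
    obtain ⟨d, hdc⟩ := hmem
    have hd := (FundamentalGroup.mapOfEq_apply q.toContinuousMap _ d).symm.trans hdc
    have cov := q.isCoveringMap
    let p₁ : Path.Homotopic.Quotient (B.proj (B.inducedMap x₀')) (B.proj (B.inducedMap u₁)) :=
      Path.Homotopic.Quotient.mk (w₁.map LeafSpace.continuous_proj)
    let p₂ : Path.Homotopic.Quotient (B.proj (B.inducedMap x₀')) (B.proj (B.inducedMap u₁)) :=
      Path.Homotopic.Quotient.mk (w₂.map LeafSpace.continuous_proj)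
    -- In the covering `q`, transport along `p₁` ends at the base of `u₁`. Transport along `c` fixes
    -- the start, and then `p₂` leads to the base of `u₂`.
    have hp : Path.Homotopic.Quotient.trans c p₂ = p₁ := by
      have h1 : c = p₁.trans p₂.symm := congrArg Path.Homotopic.Quotient.mk
        (Path.map_trans w₁ w₂.symm LeafSpace.continuous_proj)
      rw [h1, Path.Homotopic.Quotient.trans_assoc, Path.Homotopic.Quotient.symm_trans,
        Path.Homotopic.Quotient.trans_refl]
    let m₀ : q.toFun ⁻¹' {B.proj (B.inducedMap x₀')} :=
      ⟨B.inducedProj x₀', B.proj_inducedMap x₀'⟩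
    let m₁ : q.toFun ⁻¹' {B.proj (B.inducedMap u₁)} := ⟨B.inducedProj u₁, B.proj_inducedMap u₁⟩
    let m₂ : q.toFun ⁻¹' {B.proj (B.inducedMap u₁)} :=
      ⟨B.inducedProj u₂, (B.proj_inducedMap u₂).trans (congrArg B.proj hu.symm)⟩
    -- The class `c` is the image of a loop `d` in `M'`, up to a cast of its endpoints, so it lifts
    -- to a closed path.
    have hcov : cov.monodromy c m₀ = m₀ :=
      cov.monodromy_eq_of_map_eq (ex := m₀) (ey := m₀) d
        ((congrArg (fun γ => Path.Homotopic.Quotient.cast γ m₀.2 m₀.2) hd.symm).trans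
          ((Path.Homotopic.Quotient.cast_cast _ _ _ _ _).trans
            (Path.Homotopic.Quotient.cast_rfl_rfl _))).symm
    have h1 : cov.monodromy p₁ m₀ = m₁ :=
      cov.monodromy_eq_of_map_eq (ex := m₀) (ey := m₁)
        (Path.Homotopic.Quotient.mk (z₁.map LeafSpace.continuous_proj))
        (congrArg Path.Homotopic.Quotient.mk
          (Path.ext (funext fun t => B.proj_inducedMap (z₁ t).point)))
    have h2 : cov.monodromy p₂ m₀ = m₂ :=
      cov.monodromy_eq_of_map_eq (ex := m₀) (ey := m₂)
        (Path.Homotopic.Quotient.mk (z₂.map LeafSpace.continuous_proj))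
        (congrArg Path.Homotopic.Quotient.mk
          (Path.ext (funext fun t => B.proj_inducedMap (z₂ t).point)))
    have h3 := cov.monodromy_trans_apply c p₂ m₀
    rw [hp, hcov, h1, h2] at h3
    exact congrArg Subtype.val h3
  · obtain ⟨z⟩ := hΓ.mem_holonomyBundle_iff.1 hu
    -- Surjectivity: the projection of `z` is lifted to `M'`, and the lift paired with `z` is a leaf
    -- path of the induced bundle.
    let w : C(unitInterval, M) := (z.map LeafSpace.continuous_proj).toContinuousMap
    have hw : w 0 = q.toFun (B.inducedProj x₀') := by
      rw [B.proj_inducedMap]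
      exact (z.map LeafSpace.continuous_proj).source
    let m := q.isCoveringMap.liftPath w (B.inducedProj x₀') hw
    have hm : ∀ t, q.toFun (m t) = B.proj (z t).point :=
      congrFun (q.isCoveringMap.liftPath_lifts w (B.inducedProj x₀') hw)
    let f : unitInterval → B.InducedSpace q := fun t => ⟨m t, (z t).point, hm t⟩
    have hf := hΓ.continuous_leafSpace_induced (f := f) m.continuous z.continuous
    have hf0 : f 0 = x₀' := B.induced_ext
      (q.isCoveringMap.liftPath_zero w (B.inducedProj x₀') hw) (congrArg LeafSpace.point z.source)
    refine ⟨f 1, hΓ'.mem_holonomyBundle_iff.2 ⟨⟨⟨_, hf⟩, congrArg LeafSpace.mk hf0, rfl⟩⟩, ?_⟩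
    exact congrArg LeafSpace.point z.target

/-! ### The diffeomorphism of maximal leaves -/

/-- An integral manifold of the induced connection which maps injectively to `P` is an integral
manifold there. -/
theorem IsIntegralManifold.inducedMap_comp {L : Type u} [TopologicalSpace L] [ChartedSpace EM L]
    {j : L → B.InducedSpace q} (hj : (Γ.induced q).IsIntegralManifold j)
    (hinj : Function.Injective fun y => B.inducedMap (j y)) :
    Γ.IsIntegralManifold fun y => B.inducedMap (j y) := by
  have hloc := B.isLocalDiffeomorph_inducedMap (q := q)
  have hd : ∀ (y : L) (v : EM),
      (mfderiv 𝓘(ℝ, EM) 𝓘(ℝ, EP) (fun y => B.inducedMap (j y)) y v : EP) =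
        mfderiv 𝓘(ℝ, EP) 𝓘(ℝ, EP) B.inducedMap (j y) (mfderiv 𝓘(ℝ, EM) 𝓘(ℝ, EP) j y v) :=
    fun y v => congrArg (fun L : EM →L[ℝ] EP => L v)
      (mfderiv_comp y (hloc.mdifferentiable (by simp) (j y))
        (hj.contMDiff.mdifferentiableAt (by simp)))
  refine ⟨hloc.contMDiff.comp hj.contMDiff, hinj, fun y v v' h => ?_, fun y w => ?_⟩
  · let D := hloc.mfderivToContinuousLinearEquiv (by simp) (j y)
    exact hj.mfderiv_injective y (D.injective ((hd y v).symm.trans (h.trans (hd y v'))))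
  · let D := hloc.mfderivToContinuousLinearEquiv (by simp) (j y)
    have h1 := hj.mfderiv_range y (D.symm w)
    -- The induced form is by definition the form of `Γ` after the isomorphism `D`, so `D` matches
    -- the two horizontal spaces.
    have h2 : ((Γ.induced q).form (j y) (D.symm w) : EG) = Γ.form (B.inducedMap (j y)) w :=
      congrArg (Γ.form (B.inducedMap (j y))) (D.apply_symm_apply w)
    have h3 : (Γ.induced q).form (j y) (D.symm w) = 0 ↔ Γ.form (B.inducedMap (j y)) w = 0 :=
      ⟨fun h => h2.symm.trans h, fun h => h2.trans h⟩
    rw [← h3, ← h1]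
    constructor
    · rintro ⟨v, hv⟩
      exact ⟨v, D.injective ((hd y v).symm.trans (hv.trans (D.apply_symm_apply w).symm))⟩
    · rintro ⟨v, hv⟩
      exact ⟨v, (hd y v).trans ((congrArg D hv).trans (D.apply_symm_apply w))⟩

/-- If the bundle map of the induced bundle is a bijection between the holonomy bundles, it is a
diffeomorphism between the maximal leaves. -/
theorem IsFlat.exists_diffeomorph [IsManifold 𝓘(ℝ, EM) ∞ M] [IsManifold 𝓘(ℝ, EM) ∞ M']
    (hΓ : Γ.IsFlat) {x₀ : P} {x₀' : B.InducedSpace q} (hx : B.inducedMap x₀' = x₀)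
    (hbij : BijOn B.inducedMap ((Γ.induced q).holonomyBundle x₀') (Γ.holonomyBundle x₀))
    {N N' : Type u} [TopologicalSpace N] [ChartedSpace EM N] [TopologicalSpace N']
    [ChartedSpace EM N'] {i : N → P} {i' : N' → B.InducedSpace q} (hi : Γ.IsMaximalLeaf x₀ i)
    (hi' : (Γ.induced q).IsMaximalLeaf x₀' i') :
    ∃ Φ : N' ≃ₘ⟮𝓘(ℝ, EM), 𝓘(ℝ, EM)⟯ N, ∀ y : N', i (Φ y) = B.inducedMap (i' y) := by
  have := hi'.isManifold
  have := hi'.connected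
  have hr := hi.range_eq hΓ
  have hr' := hi'.range_eq hΓ.induced
  have hmem : ∀ y, i' y ∈ (Γ.induced q).holonomyBundle x₀' := fun y => hr' ▸ mem_range_self y
  have hinj : Function.Injective fun y => B.inducedMap (i' y) := fun y y' h =>
    hi'.integral.injective (hbij.injOn (hmem y) (hmem y') h)
  obtain ⟨y₀, hy₀⟩ := hi'.mem_range
  -- Injectivity on the holonomy bundle makes the upper leaf an integral manifold in `P`, and
  -- maximality of `N` supplies the smooth map.
  obtain ⟨φ, hφ, hiφ⟩ := hi.maximal N' _ (hi'.integral.inducedMap_comp hinj)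
    ⟨y₀, (congrArg B.inducedMap hy₀).trans hx⟩
  have hφb : Function.Bijective φ := by
    refine ⟨fun y y' h => hinj ?_, fun n => ?_⟩
    · simp only [← hiφ, h]
    · obtain ⟨z, hz, hzn⟩ := hbij.surjOn (hr ▸ mem_range_self n : i n ∈ Γ.holonomyBundle x₀)
      rw [← hr'] at hz
      obtain ⟨y, rfl⟩ := hz
      exact ⟨y, hi.integral.injective ((hiφ y).trans hzn)⟩
  have hloc : IsLocalDiffeomorph 𝓘(ℝ, EM) 𝓘(ℝ, EM) ∞ fun y => q.toFun (B.inducedProj (i' y)) :=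
    fun y => (hi'.isLocalDiffeomorph_proj hΓ.induced y).comp _ _ (q.isLocalDiffeomorph _)
  have hcomp : ∀ y, B.proj (i (φ y)) = q.toFun (B.inducedProj (i' y)) := fun y => by
    rw [hiφ, B.proj_inducedMap]
  have hlocal := hi.isLocalDiffeomorph_proj hΓ
  -- Over `M`, both leaves project by local diffeomorphisms compatible with `φ`, so `φ` is a local
  -- homeomorphism, and a homeomorphism since it is bijective.
  have hφl : IsLocalHomeomorph φ := by
    refine IsLocalHomeomorph.of_comp (g := fun n => B.proj (i n)) ?_ hlocal.isLocalHomeomorph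
      hφ.continuous
    rw [show (fun n => B.proj (i n)) ∘ φ = _ from funext hcomp]
    exact hloc.isLocalHomeomorph
  let e := (Equiv.ofBijective φ hφb).toHomeomorphOfContinuousOpen hφ.continuous hφl.isOpenMap
  refine ⟨⟨e.toEquiv, hφ, fun n => ?_⟩, hiφ⟩
  -- The inverse is smooth because its composite with the projection of the upper leaf to `M` is `p
  -- ∘ i`.
  refine contMDiffWithinAt_of_comp hloc e.symm.continuous.continuousWithinAt ?_ (mem_univ n)
  have h1 : (fun n => q.toFun (B.inducedProj (i' (e.symm n)))) = fun n => B.proj (i n) := by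
    funext n
    rw [← hcomp]
    exact congrArg (fun n => B.proj (i n)) (e.apply_symm_apply n)
  exact h1 ▸ hlocal.contMDiff n

end Connection

end PrincipalBundle

end FlatCovering

end

theorem proposition2p1
    {EM EG EP : Type*}
    [NormedAddCommGroup EM] [NormedSpace ℝ EM] [FiniteDimensional ℝ EM]
    [NormedAddCommGroup EG] [NormedSpace ℝ EG] [FiniteDimensional ℝ EG]
    [NormedAddCommGroup EP] [NormedSpace ℝ EP] [FiniteDimensional ℝ EP]
    {M M' P : Type u} {G : Type*}
    -- the connected paracompact manifold `M`, the Lie group `G`, the connected paracompact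
    -- manifold `P` with its `G`-action, and the connected manifold `M'`
    [TopologicalSpace M] [ChartedSpace EM M] [IsManifold 𝓘(ℝ, EM) ∞ M]
    [T2Space M] [ParacompactSpace M] [ConnectedSpace M]
    [TopologicalSpace G] [ChartedSpace EG G] [Group G] [LieGroup 𝓘(ℝ, EG) ∞ G]
    [TopologicalSpace P] [ChartedSpace EP P] [IsManifold 𝓘(ℝ, EP) ∞ P]
    [T2Space P] [ParacompactSpace P] [ConnectedSpace P] [MulAction G P]
    [TopologicalSpace M'] [ChartedSpace EM M'] [IsManifold 𝓘(ℝ, EM) ∞ M'] [ConnectedSpace M']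
    -- the principal bundle, the flat connection and the regular covering
    (B : FlatCovering.PrincipalBundle EM EG EP M G P) (Γ : B.Connection) (hΓ : Γ.IsFlat)
    (q : FlatCovering.SmoothCovering EM M M') (hq : q.IsRegular)
    -- base points `x₀` in `P` and `x₀'` in the induced bundle, over `x₀`
    (x₀ : P) (x₀' : B.InducedSpace q) (hx : B.inducedMap x₀' = x₀)
    -- `π₁(M')`, as a subgroup of `π₁(M)`, is the kernel of the holonomy morphism
    (hker : (q.pi1 ((B.proj_inducedMap x₀').trans (congrArg B.proj hx)) :
      Set (FundamentalGroup M (B.proj x₀))) = {c | Γ.holonomy x₀ c = 1}) :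
    -- the maximal leaf through `x₀` exists, and is the total space of the holonomy bundle
    (∃ (N : Type u) (_ : TopologicalSpace N) (_ : ChartedSpace EM N) (i : N → P),
      Γ.IsMaximalLeaf x₀ i ∧ Set.range i = Γ.holonomyBundle x₀) ∧
    -- so does, and is, the one through `x₀'` for the induced connection
    (∃ (N' : Type u) (_ : TopologicalSpace N') (_ : ChartedSpace EM N')
      (i' : N' → B.InducedSpace q),
      (Γ.induced q).IsMaximalLeaf x₀' i' ∧ Set.range i' = (Γ.induced q).holonomyBundle x₀') ∧
    -- the bundle map restricts to a diffeomorphism between the two leaves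
    ∀ (N : Type u) [TopologicalSpace N] [ChartedSpace EM N] (i : N → P)
      (N' : Type u) [TopologicalSpace N'] [ChartedSpace EM N'] (i' : N' → B.InducedSpace q),
      Γ.IsMaximalLeaf x₀ i → (Γ.induced q).IsMaximalLeaf x₀' i' →
      ∃ Φ : N' ≃ₘ⟮𝓘(ℝ, EM), 𝓘(ℝ, EM)⟯ N, ∀ y : N', i (Φ y) = B.inducedMap (i' y) := by
  have hbij := hΓ.bijOn_holonomyBundle hx hker
  have hΓ' := hΓ.induced (q := q)
  have hN := hΓ.isMaximalLeaf_incl (x₀ := x₀)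
  have hN' := hΓ'.isMaximalLeaf_incl (x₀ := x₀')
  exact ⟨⟨Γ.Leaf x₀, inferInstance, hΓ.leafChartedSpace x₀, _, hN, hΓ.range_incl⟩,
    ⟨(Γ.induced q).Leaf x₀', inferInstance, hΓ'.leafChartedSpace x₀', _, hN', hΓ'.range_incl⟩,
    fun N _ _ i N' _ _ i' hi hi' => hΓ.exists_diffeomorph hx hbij hi hi'⟩
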